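/- Consider a single queue with $N\ge 2$ servers in slotted time $t=0,1,2,\dots$. The arrivals $A(t)$ form a Bernoulli process of rate $\lambda\in(0,1]$, the service $D^i(t)$ offered by server $i\in[N]$ forms a Bernoulli process of rate $\mu_i\in[0,1]$, all these processes are independent, and the best server $i^*=\arg\max_i\mu_i$ is unique. A policy $\pi$ chooses at each time $t$, possibly at random, a server $u(t)$ as a function of the history $H(t)=(A(s),D(s),u(s))_{s<t}$, where $D(t)=D^{u(t)}(t)$, without knowing $\lambda$ or $\mu$. The backlog satisfies $Q^\pi(0)=0$ and $Q^\pi(t+1)=(Q^\pi(t)-D(t))^++A(t)$. Let $Q^*$ be the backlog of the controller that always schedules $i^*$, and let the queue length regret be $R^\pi_{(\lambda,\mu)}(T)=E\big[\sum_{t=0}^{T-1}Q^\pi(t)-\sum_{t=0}^{T-1}Q^*(t)\big]$. There is a policy $\pi$ (depending only on $N$) such that $R^{\pi}_{(\lambda,\mu)}(T)=O(1)$ as $T\to\infty$ for every problem $(\lambda,\mu)$ with $\mu_{i^*}>\lambda$, where the implied constant may depend on $(\lambda,\mu)$. More precisely, this holds for each of the following policies $\pi_3$. Fix a set $E\subseteq\{0,1,2,\dots\}$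 of dedicated exploration slots such that $V(n)=|E\cap\{0,\dots,n-1\}|$ satisfies $rn^\epsilon-b_1\le V(n)\le rn^\epsilon+b_2$ for all $n\ge 0$, for some constants $r,b_1,b_2>0$ and $\epsilon\in(0,1)$ (such sets exist), and fix a rule that selects a maximizer of each vector of estimates (this breaks ties). Time splits into alternating maximal empty periods ($Q=0$) and busy periods ($Q>0$), numbered so that empty period $p$ precedes busy period $p$, for $p=1,2,\dots$. * In the first slot of each empty period, $\pi_3$ schedules a server $i$ uniformly at random and uses the observed service to update the sample mean $\hat\mu_i$ (which is $0$ before its first update). In the other slots of the empty period it idles (it schedules a fixed arbitrary server and ignores the outcome). * In busy period $p$, it schedules $\arg\max_i\hat\mu_i$ for the first $p$ slots or until the queue empties. If the queue has not emptied after these $p$ slots, it runs the following learning subroutine until the queue empties. The subroutine's slots are counted by $n=0,1,\dots$, and it uses new sample means $\hat\mu^p_i$, initially $0$. If $n\in E$, it schedules a server $i$ uniformly at random and updates $\hat\mu^p_i$ with the observed service. If $n\notin E$, it schedules $\arg\max_i\hat\mu^p_i$. -/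

import Mathlib

noncomputable section

namespace QueueRegret

/-! ## The queueing system -/

/-- A problem instance with `N` servers: the arrival rate, the service rates, and the unique server
with the largest service rate. -/
structure Problem (N : ℕ) where
  /-- arrival rate `λ` -/
  lam : ℝ
  /-- service rates `μ_i` -/
  mu : Fin N → ℝ
  lam_pos : 0 < lam
  lam_le_one : lam ≤ 1
  mu_nonneg : ∀ i, 0 ≤ mu i
  mu_le_one : ∀ i, mu i ≤ 1
  /-- the best server `i*` -/
  best : Fin N
  mu_lt_best : ∀ i, i ≠ best → mu i < mu best

/-- Everything that happens in one time slot: the arrival `A(t)`, the offered services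
`(D^i(t))_i` of all the servers, and the decision `u(t)`. -/
abbrev Slot (N : ℕ) : Type := Bool × (Fin N → Bool) × Fin N

/-- What the controller sees of one time slot: `(A(t), D(t), u(t))`. -/
abbrev Obs (N : ℕ) : Type := Bool × Bool × Fin N

/-- Of the offered services only that of the chosen server is revealed: `D(t) = D^{u(t)}(t)`. -/
def observe {N : ℕ} (s : Slot N) : Obs N := (s.1, s.2.1 s.2.2, s.2.2)

/-- A (randomized) policy: the law of the decision `u(t)` given the history
`H(t) = (A(0), D(0), u(0), …, A(t-1), D(t-1), u(t-1))`. -/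
abbrev Policy (N : ℕ) : Type := (t : ℕ) → (Fin t → Obs N) → PMF (Fin N)

/-- The policy that always schedules server `i`. -/
def alwaysServe {N : ℕ} (i : Fin N) : Policy N := fun _ _ => PMF.pure i

/-- The history `H(t)` on the sample path `ω` of the first `T` slots. -/
def history {N T : ℕ} (ω : Fin T → Slot N) (t : Fin T) : Fin (t : ℕ) → Obs N :=
  fun s => observe (ω (Fin.castLE t.2.le s))

/-- The backlog `Q(t)` as a function of `H(t)`: `Q(0) = 0` and
`Q(t+1) = (Q(t) - D(t))^+ + A(t)` (the subtraction in `ℕ` is the truncated one). -/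
def backlog {N : ℕ} : {t : ℕ} → (Fin t → Obs N) → ℕ
  | 0, _ => 0
  | t + 1, h =>
      (backlog (Fin.init h : Fin t → Obs N) - (h (Fin.last t)).2.1.toNat) + (h (Fin.last t)).1.toNat

/-- `∑_{t=0}^{T-1} Q(t)` on a sample path. -/
def totalBacklog {N T : ℕ} (ω : Fin T → Slot N) : ℝ :=
  ∑ t : Fin T, (backlog (history ω t) : ℝ)

/-- The Bernoulli probability mass function with parameter `x`. -/
def bern (x : ℝ) (b : Bool) : ℝ := if b then x else 1 - x

/-- The law of the first `T` slots under the policy `π`: in each slot the arrival, the offered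
services of all the servers, and the decision drawn from `π` given the history are independent of
one another, and the arrivals and services are Bernoulli, independent of the past. -/
def pathProb {N : ℕ} (π : Policy N) (P : Problem N) (T : ℕ) (ω : Fin T → Slot N) : ℝ :=
  ∏ t : Fin T, (bern P.lam (ω t).1 * (∏ i : Fin N, bern (P.mu i) ((ω t).2.1 i)) *
    (π t (history ω t) (ω t).2.2).toReal)

/-- Queue length regret: the expectation of `∑_{t<T} Q^π(t) - ∑_{t<T} Q^*(t)` under the product of
the law of the system run by `π` and that of the system run by the controller that always
schedules the best server. -/
def regret {N : ℕ} (π : Policy N) (P : Problem N) (T : ℕ) : ℝ :=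
  ∑ ω : Fin T → Slot N, ∑ ω' : Fin T → Slot N,
    pathProb π P T ω * pathProb (alwaysServe P.best) P T ω' * (totalBacklog ω - totalBacklog ω')

/-- `R^π(T) = O(1)` as `T → ∞`. -/
def HasBoundedRegret {N : ℕ} (π : Policy N) (P : Problem N) : Prop :=
  (fun T : ℕ => regret π P T) =O[Filter.atTop] (fun _ : ℕ => (1 : ℝ))

/-! `pathProb` is a probability mass function. -/

theorem pathProb_nonneg {N : ℕ} (π : Policy N) (P : Problem N) (T : ℕ) (ω : Fin T → Slot N) :
    0 ≤ pathProb π P T ω := by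
  have hb : ∀ x : ℝ, 0 ≤ x → x ≤ 1 → ∀ b, 0 ≤ bern x b := by
    intro x h0 h1 b
    cases b <;> simp [bern, h0, h1]
  exact Finset.prod_nonneg fun t _ => mul_nonneg (mul_nonneg (hb _ P.lam_pos.le P.lam_le_one _)
    (Finset.prod_nonneg fun i _ => hb _ (P.mu_nonneg i) (P.mu_le_one i) _)) ENNReal.toReal_nonneg

theorem slot_sum {N : ℕ} (P : Problem N) (q : PMF (Fin N)) :
    ∑ s : Slot N, bern P.lam s.1 * (∏ i : Fin N, bern (P.mu i) (s.2.1 i)) * (q s.2.2).toReal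
      = 1 := by
  have hq : ∑ u : Fin N, (q u).toReal = 1 := by
    rw [← ENNReal.toReal_sum fun u _ => q.apply_ne_top u, ← tsum_fintype (L := .unconditional _),
      q.tsum_coe, ENNReal.toReal_one]
  have hd : ∑ d : Fin N → Bool, ∏ i : Fin N, bern (P.mu i) (d i) = 1 := by
    rw [← Fintype.prod_sum]
    simp [bern]
  rw [Fintype.sum_prod_type]
  simp_rw [Fintype.sum_prod_type, ← Finset.mul_sum, hq, mul_one, ← Finset.mul_sum, hd]
  simp [bern]

theorem pathProb_sum {N : ℕ} (π : Policy N) (P : Problem N) (T : ℕ) :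
    ∑ ω : Fin T → Slot N, pathProb π P T ω = 1 := by
  induction T with
  | zero => simp [pathProb]
  | succ T ih =>
    rw [← (Fin.snocEquiv fun _ => Slot N).sum_comp, Fintype.sum_prod_type, Finset.sum_comm]
    rw [← ih]
    refine Finset.sum_congr rfl fun ω _ => ?_
    have h1 : ∀ s : Slot N, pathProb π P (T + 1) ((Fin.snocEquiv fun _ => Slot N) (s, ω))
        = pathProb π P T ω * (bern P.lam s.1 * (∏ i : Fin N, bern (P.mu i) (s.2.1 i)) *
          (π T (fun j => observe (ω j)) s.2.2).toReal) := by
      intro s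
      have h2 : ∀ t : Fin T, history (N := N) (Fin.snoc (α := fun _ => Slot N) ω s) t.castSucc
          = history ω t := by
        intro t
        funext j
        simp only [history]
        congr 1
        exact Fin.snoc_castSucc (α := fun _ => Slot N) s ω (Fin.castLE t.2.le j)
      have h3 : history (N := N) (Fin.snoc (α := fun _ => Slot N) ω s) (Fin.last T)
          = fun j => observe (ω j) := by
        funext j
        simp only [history]
        congr 1
        exact Fin.snoc_castSucc (α := fun _ => Slot N) s ω j
      rw [pathProb, pathProb, Fin.prod_univ_castSucc]
      refine congrArg₂ _ (Finset.prod_congr rfl fun t _ => ?_) ?_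
      · have e : (Fin.snocEquiv fun _ => Slot N) (s, ω) t.castSucc = ω t :=
          Fin.snoc_castSucc (α := fun _ => Slot N) s ω t
        rw [e]
        exact congrArg (fun h => _ * (π t h (ω t).2.2).toReal) (h2 t)
      · have e : (Fin.snocEquiv fun _ => Slot N) (s, ω) (Fin.last T) = s :=
          Fin.snoc_last (α := fun _ => Slot N) s ω
        rw [e]
        exact congrArg (fun h => _ * (π T h s.2.2).toReal) h3
    simp_rw [h1, ← Finset.mul_sum, slot_sum, mul_one]

/-! ## The policy `π₃` -/

/-- `V(n)`: the number of dedicated exploration slots among the slots `0, …, n-1` of the learning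
subroutine, when the dedicated exploration slots are the elements of `E`. -/
def explorationCount (E : Set ℕ) (n : ℕ) : ℕ := {m | m < n ∧ m ∈ E}.ncard

/-- The dedicated exploration slots are sublinear: `r n^ε - b₁ ≤ V(n) ≤ r n^ε + b₂` for all `n`,
for some positive constants and `ε ∈ (0, 1)`. -/
def IsSublinearExploration (E : Set ℕ) : Prop :=
  ∃ r ε b₁ b₂ : ℝ, 0 < r ∧ 0 < ε ∧ ε < 1 ∧ 0 < b₁ ∧ 0 < b₂ ∧
    ∀ n : ℕ, r * (n : ℝ) ^ ε - b₁ ≤ explorationCount E n ∧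
      (explorationCount E n : ℝ) ≤ r * (n : ℝ) ^ ε + b₂

/-- `sel` picks a server whose estimate is largest (with some rule to break ties). -/
def IsArgmax {N : ℕ} (sel : (Fin N → ℝ) → Fin N) : Prop :=
  ∀ (m : Fin N → ℝ) (i : Fin N), m i ≤ m (sel m)

/-- The observations of each server that enter its sample mean. -/
structure Samples (N : ℕ) where
  /-- number of observations of server `i` that have been used -/
  count : Fin N → ℕ
  /-- sum of these observations -/
  total : Fin N → ℕ

/-- No observation yet. -/
def Samples.empty (N : ℕ) : Samples N := ⟨fun _ => 0, fun _ => 0⟩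

/-- Use the observation `d` of server `i`. -/
def Samples.update {N : ℕ} (S : Samples N) (i : Fin N) (d : Bool) : Samples N :=
  ⟨Function.update S.count i (S.count i + 1), Function.update S.total i (S.total i + d.toNat)⟩

/-- The sample means; they are `0` before the first observation (`0 / 0 = 0`). -/
def Samples.mean {N : ℕ} (S : Samples N) (i : Fin N) : ℝ := (S.total i : ℝ) / (S.count i : ℝ)

/-- The variables of `π₃`. -/
structure State (N : ℕ) where
  /-- the current backlog; the current period is empty if it is `0`, and busy otherwise -/
  queue : ℕ
  /-- the number `p = 1, 2, …` of the current empty or busy period -/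
  period : ℕ
  /-- the number of slots of the current empty or busy period that have already passed -/
  age : ℕ
  /-- the samples behind `μ̂_i`, from the first slots of the empty periods -/
  outer : Samples N
  /-- the samples behind `μ̂^p_i`, from the exploration slots of the learning subroutine in the
  current busy period -/
  inner : Samples N

/-- At time `0` the first empty period starts. -/
def State.init (N : ℕ) : State N := ⟨0, 1, 0, Samples.empty N, Samples.empty N⟩

open Classical in
/-- The decision of `π₃`. In an empty period it explores uniformly at random in the first slot and
idles (formally, schedules some fixed server, whose service is ignored) in the others. In busy
period `p` it schedules the server with the largest `μ̂_i` in the first `p` slots; from then on it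
runs the learning subroutine, whose slot number is `n = age - p`: explore uniformly at random if
`n ∈ E`, and schedule the server with the largest `μ̂^p_i` if not. -/
def State.decide {N : ℕ} (E : Set ℕ) (sel : (Fin N → ℝ) → Fin N) (idle : Fin N)
    (s : State N) : PMF (Fin N) :=
  haveI : Nonempty (Fin N) := ⟨idle⟩
  if s.queue = 0 then
    if s.age = 0 then PMF.uniformOfFintype (Fin N) else PMF.pure idle
  else if s.age < s.period then PMF.pure (sel s.outer.mean)
  else if s.age - s.period ∈ E then PMF.uniformOfFintype (Fin N)
  else PMF.pure (sel s.inner.mean)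

open Classical in
/-- The update of the variables of `π₃` with the observation `o = (A(t), D(t), u(t))`. A change
from empty to busy starts the busy period of the same number, with fresh samples for the learning
subroutine; a change from busy to empty starts the empty period of the next number. -/
def State.step {N : ℕ} (E : Set ℕ) (s : State N) (o : Obs N) : State N :=
  let q := (s.queue - o.2.1.toNat) + o.1.toNat
  if s.queue = 0 then
    { queue := q
      period := s.period
      age := if q = 0 then s.age + 1 else 0
      outer := if s.age = 0 then s.outer.update o.2.2 o.2.1 else s.outer
      inner := Samples.empty N }
  else
    { queue := q
      period := if q = 0 then s.period + 1 else s.period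
      age := if q = 0 then 0 else s.age + 1
      outer := s.outer
      inner := if s.period ≤ s.age ∧ s.age - s.period ∈ E then s.inner.update o.2.2 o.2.1
        else s.inner }

/-- The variables of `π₃` at time `t`, computed from the history `H(t)`. -/
def stateAfter {N : ℕ} (E : Set ℕ) : {t : ℕ} → (Fin t → Obs N) → State N
  | 0, _ => State.init N
  | t + 1, h => (stateAfter E (Fin.init h : Fin t → Obs N)).step E (h (Fin.last t))

/-- The policy `π₃` with dedicated exploration slots `E`, maximizer `sel`, and server `idle` for
the slots in which it idles. -/
def piThree {N : ℕ} (E : Set ℕ) (sel : (Fin N → ℝ) → Fin N) (idle : Fin N) : Policy N :=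
  fun _ h => (stateAfter E h).decide E sel idle

end QueueRegret

end

noncomputable section

namespace QueueRegret

variable {N : ℕ}

/-! ## Expectations along a sample path -/

/-! The regret is controlled by the backlog present when a wrong server is chosen. The value
function of the always-best controller has increment at most (q+1)/(μ*-λ) at q, so one deviation at
backlog q costs O(q), and nothing at q = 0. Telescoping over deviations
(`pathMean_sumBacklog_bounds`, `regret_bounds`) bounds R(T) by a constant times ∑ E[Q(t); u(t) ≠
i*]. This sum is bounded by the initial value of any nonnegative Lyapunov function W on the
variables of π₃ whose expected decrease pays the current wrong backlog (`sum_wrongBacklog_le`).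

Estimation errors enter through one exponential potential Φ of the samples: Φ ≥ 1 whenever the
selected server is wrong, and a uniform exploration contracts Φ in mean by a factor ρ < 1. In the
learning subroutine (`exists_learn_lyapunov`) a quadratic function of a compensated backlog has
drift at most -q except when a wrong server is exploited. The latter cost, of order (p+1)(n+1) in
subroutine slot n, is charged to Φ; this is affordable because ∑ (n+1) ρ^{V(n)} converges, V growing
like a power of n. Starting the subroutine in period p thus costs O((p+1)²).

If the outer estimate selects i*, exp(δQ/2), with δ = μ*-λ, contracts by ν < 1 per busy slot, so
reaching the subroutine has probability O(ν^p). If it does not, busy period p costs O((p+1)²), but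
the mean of Φ is O(ρ^p), since every empty period contributes one exploration. Both ∑ (p+1)² ν^p and
∑ (p+1)² ρ^p are finite, hence so is the initial value of W. -/

/-- The expectation of a function of what is observed in one slot in which the decision has law
`w`. -/
def stepMean (P : Problem N) (w : PMF (Fin N)) (f : Obs N → ℝ) : ℝ :=
  ∑ u, (w u).toReal * ∑ a, bern P.lam a * ∑ d, bern (P.mu u) d * f (a, d, u)

/-- The expectation of a function of the history of the first `T` slots. -/
def pathMean (π : Policy N) (P : Problem N) (T : ℕ) (f : (Fin T → Obs N) → ℝ) : ℝ :=
  ∑ ω : Fin T → Slot N, pathProb π P T ω * f (fun j => observe (ω j))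

theorem bern_nonneg {x : ℝ} (h0 : 0 ≤ x) (h1 : x ≤ 1) (b : Bool) : 0 ≤ bern x b := by
  cases b <;> simp [bern, h0, h1]

theorem sum_bern (x : ℝ) : ∑ b, bern x b = 1 := by simp [bern]

theorem sum_bern_mul (x : ℝ) (f : Bool → ℝ) :
    ∑ b, bern x b * f b = x * f true + (1 - x) * f false := by simp [bern]

theorem sum_toReal (w : PMF (Fin N)) : ∑ u : Fin N, (w u).toReal = 1 := by
  rw [← ENNReal.toReal_sum fun u _ => w.apply_ne_top u, ← tsum_fintype (L := .unconditional _),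
    w.tsum_coe, ENNReal.toReal_one]

/-- The factor g can be absorbed into coordinate u of the product measure; every other coordinate
then sums to 1. -/
theorem sum_prod_bern_mul (P : Problem N) (u : Fin N) (g : Bool → ℝ) :
    ∑ D : Fin N → Bool, (∏ i, bern (P.mu i) (D i)) * g (D u) = ∑ d, bern (P.mu u) d * g d := by
  have h : ∀ D : Fin N → Bool, (∏ i, bern (P.mu i) (D i)) * g (D u)
      = ∏ i, bern (P.mu i) (D i) * (if i = u then g (D i) else 1) := by
    intro D
    rw [Finset.prod_mul_distrib, Finset.prod_ite_eq' Finset.univ u (fun i => g (D i))]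
    simp
  simp_rw [h]
  rw [← Fintype.prod_sum (fun i b => bern (P.mu i) b * (if i = u then g b else 1))]
  rw [Finset.prod_eq_single u]
  · simp
  · intro i _ hi
    simp [hi, bern]
  · simp

theorem slot_sum_observe (P : Problem N) (w : PMF (Fin N)) (f : Obs N → ℝ) :
    ∑ s : Slot N, bern P.lam s.1 * (∏ i : Fin N, bern (P.mu i) (s.2.1 i)) * (w s.2.2).toReal *
      f (observe s) = stepMean P w f := by
  have h : ∀ a : Bool, ∑ y : (Fin N → Bool) × Fin N, bern P.lam a *
      (∏ i : Fin N, bern (P.mu i) (y.1 i)) * (w y.2).toReal * f (observe (a, y))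
      = ∑ u, (w u).toReal * (bern P.lam a * ∑ d, bern (P.mu u) d * f (a, d, u)) := by
    intro a
    rw [Fintype.sum_prod_type, Finset.sum_comm]
    refine Finset.sum_congr rfl fun u _ => ?_
    rw [← sum_prod_bern_mul P u (fun d => f (a, d, u)), Finset.mul_sum, Finset.mul_sum]
    refine Finset.sum_congr rfl fun D _ => ?_
    simp only [observe]
    ring
  rw [Fintype.sum_prod_type, stepMean]
  simp_rw [h]
  rw [Finset.sum_comm]
  exact Finset.sum_congr rfl fun u _ => (Finset.mul_sum _ _ _).symm

theorem stepMean_mono (P : Problem N) (w : PMF (Fin N)) {f g : Obs N → ℝ} (h : ∀ o, f o ≤ g o) :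
    stepMean P w f ≤ stepMean P w g := by
  refine Finset.sum_le_sum fun u _ => mul_le_mul_of_nonneg_left ?_ ENNReal.toReal_nonneg
  refine Finset.sum_le_sum fun a _ =>
    mul_le_mul_of_nonneg_left ?_ (bern_nonneg P.lam_pos.le P.lam_le_one a)
  exact Finset.sum_le_sum fun d _ =>
    mul_le_mul_of_nonneg_left (h _) (bern_nonneg (P.mu_nonneg u) (P.mu_le_one u) d)

theorem stepMean_add (P : Problem N) (w : PMF (Fin N)) (f g : Obs N → ℝ) :
    stepMean P w (fun o => f o + g o) = stepMean P w f + stepMean P w g := by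
  simp only [stepMean, mul_add, Finset.sum_add_distrib]

theorem stepMean_const_mul (P : Problem N) (w : PMF (Fin N)) (c : ℝ) (f : Obs N → ℝ) :
    stepMean P w (fun o => c * f o) = c * stepMean P w f := by
  simp only [stepMean, Finset.mul_sum]
  refine Finset.sum_congr rfl fun u _ => Finset.sum_congr rfl fun a _ =>
    Finset.sum_congr rfl fun d _ => by ring

theorem stepMean_const (P : Problem N) (w : PMF (Fin N)) (c : ℝ) :
    stepMean P w (fun _ => c) = c := by
  simp only [stepMean, ← Finset.sum_mul, sum_bern, one_mul, sum_toReal]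

theorem pathProb_snoc (π : Policy N) (P : Problem N) (T : ℕ) (ω : Fin T → Slot N) (s : Slot N) :
    pathProb π P (T + 1) (Fin.snoc (α := fun _ => Slot N) ω s)
      = pathProb π P T ω * (bern P.lam s.1 * (∏ i : Fin N, bern (P.mu i) (s.2.1 i)) *
          (π T (fun j => observe (ω j)) s.2.2).toReal) := by
  have h2 : ∀ t : Fin T, history (N := N) (Fin.snoc (α := fun _ => Slot N) ω s) t.castSucc
      = history ω t := by
    intro t
    funext j
    exact congrArg observe
      (Fin.snoc_castSucc (α := fun _ => Slot N) s ω (Fin.castLE t.2.le j))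
  have h3 : history (N := N) (Fin.snoc (α := fun _ => Slot N) ω s) (Fin.last T)
      = fun j => observe (ω j) := by
    funext j
    exact congrArg observe (Fin.snoc_castSucc (α := fun _ => Slot N) s ω j)
  rw [pathProb, pathProb, Fin.prod_univ_castSucc]
  refine congrArg₂ _ (Finset.prod_congr rfl fun t _ => ?_) ?_
  · rw [Fin.snoc_castSucc (α := fun _ => Slot N) s ω t]
    exact congrArg (fun h => _ * (π t h (ω t).2.2).toReal) (h2 t)
  · rw [Fin.snoc_last (α := fun _ => Slot N) s ω]
    exact congrArg (fun h => _ * (π T h s.2.2).toReal) h3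

/-- The tower property, conditioning on H(T). It reduces every path estimate below to a one-slot
estimate. -/
theorem pathMean_succ (π : Policy N) (P : Problem N) (T : ℕ) (f : (Fin (T + 1) → Obs N) → ℝ) :
    pathMean π P (T + 1) f = pathMean π P T
      (fun h => stepMean P (π T h) (fun o => f (Fin.snoc (α := fun _ => Obs N) h o))) := by
  rw [pathMean, pathMean, ← (Fin.snocEquiv fun _ => Slot N).sum_comp, Fintype.sum_prod_type,
    Finset.sum_comm]
  refine Finset.sum_congr rfl fun ω _ => ?_
  rw [← slot_sum_observe, Finset.mul_sum]
  refine Finset.sum_congr rfl fun s _ => ?_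
  change pathProb π P (T + 1) (Fin.snoc (α := fun _ => Slot N) ω s) *
    f (observe ∘ Fin.snoc (α := fun _ => Slot N) ω s) = _
  rw [pathProb_snoc, Fin.comp_snoc]
  simp only [Function.comp_def]
  ring

theorem pathMean_mono (π : Policy N) (P : Problem N) (T : ℕ) {f g : (Fin T → Obs N) → ℝ}
    (h : ∀ x, f x ≤ g x) : pathMean π P T f ≤ pathMean π P T g :=
  Finset.sum_le_sum fun ω _ => mul_le_mul_of_nonneg_left (h _) (pathProb_nonneg π P T ω)

theorem pathMean_add (π : Policy N) (P : Problem N) (T : ℕ) (f g : (Fin T → Obs N) → ℝ) :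
    pathMean π P T (fun h => f h + g h) = pathMean π P T f + pathMean π P T g := by
  simp only [pathMean, mul_add, Finset.sum_add_distrib]

theorem pathMean_const_mul (π : Policy N) (P : Problem N) (T : ℕ) (c : ℝ)
    (f : (Fin T → Obs N) → ℝ) :
    pathMean π P T (fun h => c * f h) = c * pathMean π P T f := by
  simp only [pathMean, Finset.mul_sum]
  exact Finset.sum_congr rfl fun ω _ => by ring

theorem pathMean_zero (π : Policy N) (P : Problem N) (f : (Fin 0 → Obs N) → ℝ) :
    pathMean π P 0 f = f Fin.elim0 := by
  simp only [pathMean, Fintype.sum_unique, pathProb, Finset.univ_eq_empty, Finset.prod_empty,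
    one_mul]
  exact congrArg f (Subsingleton.elim _ _)

theorem backlog_snoc {t : ℕ} (h : Fin t → Obs N) (o : Obs N) :
    backlog (Fin.snoc (α := fun _ => Obs N) h o : Fin (t + 1) → Obs N)
      = (backlog h - o.2.1.toNat) + o.1.toNat := by
  rw [backlog, Fin.init_snoc, Fin.snoc_last]

/-- The sum of the backlogs at the times before `T`, as a function of the history. -/
def sumBacklog {T : ℕ} (h : Fin T → Obs N) : ℝ :=
  ∑ t : Fin T, (backlog (fun s : Fin (t : ℕ) => h (Fin.castLE t.2.le s)) : ℝ)

theorem sumBacklog_snoc {T : ℕ} (h : Fin T → Obs N) (o : Obs N) :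
    sumBacklog (Fin.snoc (α := fun _ => Obs N) h o : Fin (T + 1) → Obs N)
      = sumBacklog h + backlog h := by
  rw [sumBacklog, Fin.sum_univ_castSucc]
  congr 1
  · refine Finset.sum_congr rfl fun t _ => ?_
    have e : (fun s : Fin (t : ℕ) => (Fin.snoc (α := fun _ => Obs N) h o : Fin (T + 1) → Obs N)
        (Fin.castLE t.castSucc.2.le s)) = fun s => h (Fin.castLE t.2.le s) := by
      funext s
      exact Fin.snoc_castSucc (α := fun _ => Obs N) o h (Fin.castLE t.2.le s)
    exact congrArg (fun x => (backlog x : ℝ)) e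
  · have e : (fun s : Fin T => (Fin.snoc (α := fun _ => Obs N) h o : Fin (T + 1) → Obs N)
        (Fin.castLE (Fin.last T).2.le s)) = h := by
      funext s
      exact Fin.snoc_castSucc (α := fun _ => Obs N) o h s
    exact congrArg (fun x => (backlog x : ℝ)) e

theorem regret_eq (π : Policy N) (P : Problem N) (T : ℕ) :
    regret π P T = pathMean π P T sumBacklog - pathMean (alwaysServe P.best) P T sumBacklog := by
  have h : ∀ ω : Fin T → Slot N, totalBacklog ω = sumBacklog fun j => observe (ω j) :=
    fun _ => rfl
  simp only [regret, pathMean, h, mul_sub, Finset.sum_sub_distrib]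
  congr 1
  · refine Finset.sum_congr rfl fun ω _ => ?_
    rw [← Finset.sum_mul, ← Finset.mul_sum, pathProb_sum, mul_one]
  · rw [Finset.sum_comm]
    refine Finset.sum_congr rfl fun ω _ => ?_
    rw [← Finset.sum_mul, ← Finset.sum_mul, pathProb_sum, one_mul]

/-! ## The performance difference -/

/-- The expectation of `g` one slot after the backlog was `q`, when the best server is
scheduled. -/
def bestStep (P : Problem N) (g : ℕ → ℝ) (q : ℕ) : ℝ :=
  ∑ a, bern P.lam a * ∑ d, bern (P.mu P.best) d * g ((q - d.toNat) + a.toNat)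

/-- The expected total backlog over `k` slots, started from `q`, of the controller that always
schedules the best server. -/
def bestValue (P : Problem N) : ℕ → ℕ → ℝ
  | 0, _ => 0
  | k + 1, q => q + bestStep P (bestValue P k) q

theorem bestStep_eq (P : Problem N) (g : ℕ → ℝ) (q : ℕ) :
    bestStep P g q = P.lam * (P.mu P.best * g (q - 1 + 1) + (1 - P.mu P.best) * g (q + 1)) +
      (1 - P.lam) * (P.mu P.best * g (q - 1) + (1 - P.mu P.best) * g q) := by
  simp [bestStep, bern]

/-- Two coupled copies started one customer apart remain at distance at most one, and merge when the
lower is empty and service is offered. The upper bound is the drain time of q+1 customers at drift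
μ*-λ: with C the inverse drift, the induction uses 1 + C(q+1) - C(μ*-λ) = C(q+1). -/
theorem bestValue_diff (P : Problem N) (h : P.lam < P.mu P.best) (k q : ℕ) :
    0 ≤ bestValue P k (q + 1) - bestValue P k q ∧
      bestValue P k (q + 1) - bestValue P k q ≤ (P.mu P.best - P.lam)⁻¹ * (q + 1) := by
  have hl := P.lam_pos
  have hl1 := P.lam_le_one
  have hm1 := P.mu_le_one P.best
  have hm0 := P.mu_nonneg P.best
  set m := P.mu P.best with hm
  have hd : 0 < m - P.lam := by linarith
  set C := (m - P.lam)⁻¹ with hC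
  have hCd : C * (m - P.lam) = 1 := inv_mul_cancel₀ hd.ne'
  have hC0 : 0 < C := inv_pos.2 hd
  have e1 : 0 ≤ P.lam * m := by positivity
  have e2 : 0 ≤ P.lam * (1 - m) := mul_nonneg hl.le (by linarith)
  have e3 : 0 ≤ (1 - P.lam) * m := mul_nonneg (by linarith) hm0
  have e4 : 0 ≤ (1 - P.lam) * (1 - m) := mul_nonneg (by linarith) (by linarith)
  induction k generalizing q with
  | zero => simp only [bestValue, sub_self, le_refl, true_and]; positivity
  | succ k ih =>
    simp only [bestValue, bestStep_eq, ← hm]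
    rcases q with _ | q
    · obtain ⟨a0, a1⟩ := ih 0
      obtain ⟨b0, b1⟩ := ih 1
      norm_num at a0 a1 b0 b1 ⊢
      refine ⟨by linarith [mul_nonneg e2 (sub_nonneg.2 b0), mul_nonneg e4 (sub_nonneg.2 a0)], ?_⟩
      have t1 := mul_le_mul_of_nonneg_left b1 e2
      have t2 := mul_le_mul_of_nonneg_left a1 e4
      linarith [mul_nonneg hC0.le e1]
    · obtain ⟨a0, a1⟩ := ih q
      obtain ⟨b0, b1⟩ := ih (q + 1)
      obtain ⟨c0, c1⟩ := ih (q + 1 + 1)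
      simp only [Nat.add_sub_cancel]
      push_cast at a1 b1 c1 ⊢
      refine ⟨by linarith [mul_nonneg e2 c0, mul_nonneg e4 b0, mul_nonneg e1 b0,
        mul_nonneg e3 a0], ?_⟩
      have t1 := mul_le_mul_of_nonneg_left c1 e2
      have t2 := mul_le_mul_of_nonneg_left b1 e4
      have t3 := mul_le_mul_of_nonneg_left b1 e1
      have t4 := mul_le_mul_of_nonneg_left a1 e3
      linarith

theorem one_sub_toReal_nonneg (w : PMF (Fin N)) (u : Fin N) : 0 ≤ 1 - (w u).toReal := by
  rw [← sum_toReal w, sub_nonneg]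
  exact Finset.single_le_sum (f := fun u => (w u).toReal) (fun _ _ => ENNReal.toReal_nonneg)
    (Finset.mem_univ u)

theorem Problem.mu_le_best (P : Problem N) (u : Fin N) : P.mu u ≤ P.mu P.best := by
  by_cases h : u = P.best
  · rw [h]
  · exact (P.mu_lt_best u h).le

/-- The difference factors as the mean shortfall in service rate times an averaged discrete
derivative D of g. Since D vanishes at q = 0, a wrong decision on an empty queue is free, and C(q+1)
can be replaced by 2Cq. -/
theorem stepMean_sub_bestStep (P : Problem N) (w : PMF (Fin N)) {g : ℕ → ℝ} {C : ℝ}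
    (hC : 0 ≤ C) (hg : ∀ q : ℕ, 0 ≤ g (q + 1) - g q ∧ g (q + 1) - g q ≤ C * (q + 1)) (q : ℕ) :
    0 ≤ stepMean P w (fun o => g ((q - o.2.1.toNat) + o.1.toNat)) - bestStep P g q ∧
    stepMean P w (fun o => g ((q - o.2.1.toNat) + o.1.toNat)) - bestStep P g q
      ≤ 2 * C * (q * (1 - (w P.best).toReal)) := by
  set D := P.lam * (g (q + 1) - g (q - 1 + 1)) + (1 - P.lam) * (g q - g (q - 1)) with hD
  have hl := P.lam_pos
  have hl1 := P.lam_le_one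
  have key : stepMean P w (fun o => g ((q - o.2.1.toNat) + o.1.toNat)) - bestStep P g q
      = (∑ u, (w u).toReal * (P.mu P.best - P.mu u)) * D := by
    have h1 : bestStep P g q = ∑ u, (w u).toReal * bestStep P g q := by
      rw [← Finset.sum_mul, sum_toReal, one_mul]
    rw [h1, stepMean, ← Finset.sum_sub_distrib, Finset.sum_mul]
    refine Finset.sum_congr rfl fun u _ => ?_
    rw [bestStep_eq, sum_bern_mul, sum_bern_mul, sum_bern_mul, hD]
    simp
    ring
  have hD0 : 0 ≤ D ∧ D ≤ 2 * C * q := by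
    rcases q with _ | q
    · simp [hD]
    · obtain ⟨a0, a1⟩ := hg q
      obtain ⟨b0, b1⟩ := hg (q + 1)
      simp only [Nat.add_sub_cancel] at hD
      push_cast at *
      have hl1' : 0 ≤ 1 - P.lam := by linarith
      constructor
      · rw [hD]; exact add_nonneg (mul_nonneg hl.le b0) (mul_nonneg hl1' a0)
      · have t1 := mul_le_mul_of_nonneg_left b1 hl.le
        have t2 := mul_le_mul_of_nonneg_left a1 hl1'
        rw [hD]
        nlinarith [mul_nonneg hC hl1', mul_nonneg hC (Nat.cast_nonneg (α := ℝ) q)]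
  have hS0 : 0 ≤ ∑ u, (w u).toReal * (P.mu P.best - P.mu u) :=
    Finset.sum_nonneg fun u _ => mul_nonneg ENNReal.toReal_nonneg
      (sub_nonneg.2 (P.mu_le_best u))
  have hS1 : ∑ u, (w u).toReal * (P.mu P.best - P.mu u) ≤ 1 - (w P.best).toReal := by
    rw [← sum_toReal w, ← Finset.add_sum_erase _ _ (Finset.mem_univ P.best),
      ← Finset.add_sum_erase _ (fun u => (w u).toReal) (Finset.mem_univ P.best), sub_self,
      mul_zero, zero_add, add_sub_cancel_left]
    refine Finset.sum_le_sum fun u _ => mul_le_of_le_one_right ENNReal.toReal_nonneg ?_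
    linarith [P.mu_nonneg u, P.mu_le_one P.best]
  rw [key]
  refine ⟨mul_nonneg hS0 hD0.1, ?_⟩
  calc _ ≤ (1 - (w P.best).toReal) * (2 * C * q) :=
        mul_le_mul hS1 hD0.2 hD0.1 (one_sub_toReal_nonneg w _)
    _ = _ := by ring

/-- The expected backlog at time `t` on the event that a server other than the best is
scheduled. -/
def wrongBacklog (π : Policy N) (P : Problem N) (t : ℕ) : ℝ :=
  pathMean π P t fun h => backlog h * (1 - (π t h P.best).toReal)

/-- The middle quantity is the cost of following π for T slots and the best server for k more.
Induction on T replaces one slot of π by one of the best server, which needs all k at once. -/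
theorem pathMean_sumBacklog_bounds (π : Policy N) (P : Problem N) (h : P.lam < P.mu P.best)
    (T k : ℕ) :
    bestValue P (T + k) 0 ≤ pathMean π P T (fun x => sumBacklog x + bestValue P k (backlog x)) ∧
    pathMean π P T (fun x => sumBacklog x + bestValue P k (backlog x)) ≤ bestValue P (T + k) 0 +
      2 * (P.mu P.best - P.lam)⁻¹ * ∑ t ∈ Finset.range T, wrongBacklog π P t := by
  have hC : 0 ≤ (P.mu P.best - P.lam)⁻¹ := inv_nonneg.2 (by linarith)
  induction T generalizing k with
  | zero => simp [pathMean_zero, sumBacklog, backlog]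
  | succ T ih =>
    obtain ⟨i1, i2⟩ := ih (k + 1)
    have hk : T + 1 + k = T + (k + 1) := by ring
    have hd := fun x : Fin T → Obs N => stepMean_sub_bestStep P (π T x) hC
      (fun q => bestValue_diff P h k q) (backlog x)
    rw [hk, pathMean_succ]
    have e : (fun x : Fin T → Obs N => stepMean P (π T x) fun o =>
        sumBacklog (Fin.snoc (α := fun _ => Obs N) x o : Fin (T + 1) → Obs N) +
          bestValue P k (backlog (Fin.snoc (α := fun _ => Obs N) x o : Fin (T + 1) → Obs N)))
        = fun x => (sumBacklog x + backlog x) + stepMean P (π T x) fun o =>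
          bestValue P k ((backlog x - o.2.1.toNat) + o.1.toNat) := by
      funext x
      simp only [sumBacklog_snoc, backlog_snoc]
      rw [stepMean_add, stepMean_const]
    rw [e]
    constructor
    · refine i1.trans (pathMean_mono π P T fun x => ?_)
      rw [bestValue]
      linarith [(hd x).1]
    · rw [Finset.sum_range_succ, mul_add, ← add_assoc]
      refine le_trans ?_ (add_le_add_left i2 _)
      rw [wrongBacklog, ← pathMean_const_mul, ← pathMean_add]
      refine pathMean_mono π P T fun x => ?_
      rw [bestValue]
      linarith [(hd x).2]

/-- The previous bounds with k = 0, applied also to the always-best controller: its wrong backlog is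
zero, so its cost is exactly `bestValue P T 0`. -/
theorem regret_bounds (π : Policy N) (P : Problem N) (h : P.lam < P.mu P.best) (T : ℕ) :
    0 ≤ regret π P T ∧ regret π P T ≤
      2 * (P.mu P.best - P.lam)⁻¹ * ∑ t ∈ Finset.range T, wrongBacklog π P t := by
  have h1 := pathMean_sumBacklog_bounds π P h T 0
  have h2 := pathMean_sumBacklog_bounds (alwaysServe P.best) P h T 0
  have h3 : ∀ t, wrongBacklog (alwaysServe P.best) P t = 0 := by
    intro t
    simp [wrongBacklog, alwaysServe, pathMean]
  simp only [bestValue, add_zero, h3, Finset.sum_const_zero, mul_zero] at h1 h2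
  rw [regret_eq]
  constructor <;> linarith [h1.1, h1.2, h2.1, h2.2]

theorem hasBoundedRegret_of_sum_le (π : Policy N) (P : Problem N) (h : P.lam < P.mu P.best)
    (c : ℝ) (hc : ∀ T, ∑ t ∈ Finset.range T, wrongBacklog π P t ≤ c) :
    HasBoundedRegret π P := by
  refine Asymptotics.IsBigO.of_bound (2 * (P.mu P.best - P.lam)⁻¹ * c)
    (Filter.Eventually.of_forall fun T => ?_)
  obtain ⟨h1, h2⟩ := regret_bounds π P h T
  rw [Real.norm_of_nonneg h1, norm_one, mul_one]
  refine h2.trans (mul_le_mul_of_nonneg_left (hc T) ?_)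
  have : 0 ≤ (P.mu P.best - P.lam)⁻¹ := inv_nonneg.2 (by linarith)
  positivity

/-! ## Lyapunov functions on the variables of `π₃` -/

theorem State.step_queue (E : Set ℕ) (s : State N) (o : Obs N) :
    (s.step E o).queue = (s.queue - o.2.1.toNat) + o.1.toNat := by
  unfold State.step
  split_ifs <;> rfl

theorem stateAfter_queue (E : Set ℕ) {t : ℕ} (h : Fin t → Obs N) :
    (stateAfter E h).queue = backlog h := by
  induction t with
  | zero => rfl
  | succ t ih => rw [stateAfter, State.step_queue, ih, backlog]

theorem stateAfter_snoc (E : Set ℕ) {t : ℕ} (h : Fin t → Obs N) (o : Obs N) :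
    stateAfter E (Fin.snoc (α := fun _ => Obs N) h o : Fin (t + 1) → Obs N)
      = (stateAfter E h).step E o := by
  rw [stateAfter, Fin.init_snoc, Fin.snoc_last]

/-- Foster's criterion: W plus the wrong backlog accumulated so far is a supermartingale, and the
final W is dropped by nonnegativity. -/
theorem sum_wrongBacklog_le (P : Problem N) (E : Set ℕ) (sel : (Fin N → ℝ) → Fin N)
    (idle : Fin N) (W : State N → ℝ) (Inv : State N → Prop) (h_init : Inv (State.init N))
    (h_step : ∀ s o, Inv s → Inv (s.step E o)) (h_nonneg : ∀ s, Inv s → 0 ≤ W s)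
    (h_drift : ∀ s, Inv s → stepMean P (s.decide E sel idle) (fun o => W (s.step E o)) +
      s.queue * (1 - (s.decide E sel idle P.best).toReal) ≤ W s) (T : ℕ) :
    ∑ t ∈ Finset.range T, wrongBacklog (piThree E sel idle) P t ≤ W (State.init N) := by
  have hInv : ∀ {t : ℕ} (h : Fin t → Obs N), Inv (stateAfter E h) := by
    intro t
    induction t with
    | zero => exact fun _ => h_init
    | succ t ih => exact fun h => h_step _ _ (ih _)
  have key : ∑ t ∈ Finset.range T, wrongBacklog (piThree E sel idle) P t +
      pathMean (piThree E sel idle) P T (fun h => W (stateAfter E h)) ≤ W (State.init N) := by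
    induction T with
    | zero => simp [pathMean_zero, stateAfter]
    | succ T ih =>
      refine le_trans ?_ ih
      rw [Finset.sum_range_succ, add_assoc, pathMean_succ, wrongBacklog, ← pathMean_add]
      refine add_le_add_right (pathMean_mono _ _ _ fun h => ?_) _
      simp only [stateAfter_snoc]
      rw [← stateAfter_queue E, add_comm]
      exact h_drift _ (hInv h)
  have h0 : 0 ≤ pathMean (piThree E sel idle) P T (fun h => W (stateAfter E h)) :=
    Finset.sum_nonneg fun ω _ => mul_nonneg (pathProb_nonneg _ _ _ _) (h_nonneg _ (hInv _))
  linarith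

theorem sum_pure_mul (i : Fin N) (f : Fin N → ℝ) :
    ∑ u, (PMF.pure i u).toReal * f u = f i := by
  rw [Finset.sum_eq_single i]
  · simp
  · intro j _ hj
    simp [PMF.pure_apply, hj]
  · simp

theorem stepMean_arrival_sub_service (P : Problem N) (w : PMF (Fin N)) :
    stepMean P w (fun o => (o.1.toNat : ℝ) - o.2.1.toNat)
      = P.lam - ∑ u, (w u).toReal * P.mu u := by
  have h1 : P.lam = ∑ u, (w u).toReal * P.lam := by
    rw [← Finset.sum_mul, sum_toReal, one_mul]
  conv_rhs => rw [h1]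
  rw [stepMean, ← Finset.sum_sub_distrib]
  refine Finset.sum_congr rfl fun u _ => ?_
  rw [sum_bern_mul, sum_bern_mul, sum_bern_mul]
  simp
  ring

theorem cast_backlog_step {q : ℕ} (hq : q ≠ 0) (o : Obs N) :
    (((q - o.2.1.toNat) + o.1.toNat : ℕ) : ℝ) = q + ((o.1.toNat : ℝ) - o.2.1.toNat) := by
  have h : o.2.1.toNat ≤ q := (Bool.toNat_le _).trans (Nat.one_le_iff_ne_zero.2 hq)
  push_cast [Nat.cast_sub h]
  ring

theorem exp_le_one_add_add_sq {x : ℝ} (hx : |x| ≤ 1) : Real.exp x ≤ 1 + x + x ^ 2 := by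
  have := (abs_le.1 (Real.abs_exp_sub_one_sub_id_le hx)).2
  linarith

/-! ## Samples -/

/-- No server has more successes than observations. -/
def Samples.Valid (S : Samples N) : Prop := ∀ i, S.total i ≤ S.count i

theorem Samples.valid_empty : (Samples.empty N).Valid := fun _ => le_rfl

theorem Samples.Valid.update {S : Samples N} (hS : S.Valid) (i : Fin N) (d : Bool) :
    (S.update i d).Valid := by
  intro j
  by_cases h : j = i
  · subst h
    simpa [Samples.update] using add_le_add (hS j) (Bool.toNat_le d)
  · simpa [Samples.update, h] using hS j

/-- The exponential weight, with the sign `-1` for the best server and `1` for the others, of the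
deviation of the samples of server `i` from the threshold `m`. -/
def Samples.weight (P : Problem N) (θ m : ℝ) (S : Samples N) (i : Fin N) : ℝ :=
  Real.exp (θ * ((if i = P.best then -1 else 1) * ((S.total i : ℝ) - m * S.count i)))

/-- The total exponential weight of the samples, which bounds the indicator of the event that a
server other than the best has the largest sample mean. -/
def Samples.potential (P : Problem N) (θ m : ℝ) (S : Samples N) : ℝ := ∑ i, S.weight P θ m i

theorem Samples.potential_nonneg (P : Problem N) (θ m : ℝ) (S : Samples N) :
    0 ≤ S.potential P θ m := Finset.sum_nonneg fun _ _ => (Real.exp_pos _).le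

/-- If j looks at least as good as the best server, then either the best server's mean is at most m
or that of j exceeds m, so one of the two exponents is nonnegative. -/
theorem Samples.one_le_potential (P : Problem N) {θ m : ℝ} (hθ : 0 ≤ θ) (hm : 0 ≤ m)
    {S : Samples N} (hS : S.Valid) {j : Fin N} (hj : j ≠ P.best)
    (hmean : S.mean P.best ≤ S.mean j) : 1 ≤ S.potential P θ m := by
  have hw : ∀ i, 0 ≤ (if i = P.best then (-1 : ℝ) else 1) * ((S.total i : ℝ) - m * S.count i) →
      1 ≤ S.potential P θ m := fun i hi =>
    (Real.one_le_exp (mul_nonneg hθ hi)).trans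
      (Finset.single_le_sum (f := S.weight P θ m) (fun _ _ => (Real.exp_pos _).le)
        (Finset.mem_univ i))
  rcases le_or_gt (S.mean P.best) m with h | h
  · refine hw P.best ?_
    have : (S.total P.best : ℝ) ≤ m * S.count P.best := by
      -- Without observations the default mean 0 carries no information; validity forces the total
      -- to be 0, so the weight is exactly 1.
      rcases Nat.eq_zero_or_pos (S.count P.best) with h0 | h0
      · have := hS P.best
        rw [h0] at this ⊢
        simp [Nat.le_zero.1 this]
      · exact (div_le_iff₀ (by exact_mod_cast h0)).1 h
    simpa using this
  · refine hw j ?_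
    have h2 : m < (S.total j : ℝ) / S.count j := lt_of_lt_of_le h hmean
    have h0 : 0 < S.count j := by
      rcases Nat.eq_zero_or_pos (S.count j) with h0 | h0
      · simp [h0] at h2
        linarith
      · exact h0
    have := (lt_div_iff₀ (by exact_mod_cast h0)).1 h2
    simp [hj]
    linarith

theorem Samples.potential_update (P : Problem N) (θ m : ℝ) (S : Samples N) (u : Fin N) (d : Bool) :
    (S.update u d).potential P θ m = S.potential P θ m + S.weight P θ m u *
      (Real.exp (θ * ((if u = P.best then -1 else 1) * ((d.toNat : ℝ) - m))) - 1) := by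
  rw [Samples.potential, Samples.potential, ← Finset.add_sum_erase _ _ (Finset.mem_univ u),
    ← Finset.add_sum_erase _ (S.weight P θ m) (Finset.mem_univ u)]
  have h1 : (S.update u d).weight P θ m u = S.weight P θ m u *
      Real.exp (θ * ((if u = P.best then -1 else 1) * ((d.toNat : ℝ) - m))) := by
    rw [Samples.weight, Samples.weight, ← Real.exp_add]
    simp only [Samples.update, Function.update_self]
    push_cast
    congr 1
    ring
  have h2 : ∑ i ∈ Finset.univ.erase u, (S.update u d).weight P θ m i
      = ∑ i ∈ Finset.univ.erase u, S.weight P θ m i := by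
    refine Finset.sum_congr rfl fun i hi => ?_
    simp [Samples.weight, Samples.update, (Finset.mem_erase.1 hi).1]
  rw [h1, h2]
  ring

/-- A Chernoff step with θ = Δ/2: the signed deviation has mean at most -Δ, so the weight of the
sampled server contracts by 1 - Δ²/2 + Δ²/4. Each server is sampled with probability 1/N. -/
theorem stepMean_uniform_potential [Nonempty (Fin N)] (P : Problem N) {m Δ : ℝ} (hΔ : 0 < Δ)
    (hΔ1 : Δ ≤ 1) (hm0 : 0 ≤ m) (hm1 : m ≤ 1) (hbest : m + Δ ≤ P.mu P.best)
    (hother : ∀ i, i ≠ P.best → P.mu i ≤ m - Δ) (S : Samples N) :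
    stepMean P (PMF.uniformOfFintype (Fin N))
      (fun o => (S.update o.2.2 o.2.1).potential P (Δ / 2) m)
      ≤ (1 - Δ ^ 2 / (4 * N)) * S.potential P (Δ / 2) m := by
  have hN : (0 : ℝ) < N := by
    exact_mod_cast Fin.pos_iff_nonempty.2 inferInstance
  have hu : ∀ u : Fin N, (PMF.uniformOfFintype (Fin N) u).toReal = (N : ℝ)⁻¹ := by
    intro u
    simp
  have hmul : ∀ u : Fin N, ∑ a, bern P.lam a * ∑ d, bern (P.mu u) d *
      (S.update u d).potential P (Δ / 2) m
      ≤ S.potential P (Δ / 2) m - Δ ^ 2 / 4 * S.weight P (Δ / 2) m u := by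
    intro u
    rw [← Finset.sum_mul, sum_bern, one_mul, sum_bern_mul, Samples.potential_update,
      Samples.potential_update]
    set σ : ℝ := if u = P.best then -1 else 1 with hσ
    have hσ2 : σ ^ 2 = 1 := by rw [hσ]; split_ifs <;> norm_num
    have hσm : σ * (P.mu u - m) ≤ -Δ := by
      rw [hσ]
      split_ifs with h
      · rw [h]; linarith
      · linarith [hother u h]
    have hσa : |σ| = 1 := by rw [hσ]; split_ifs <;> norm_num
    have hb : ∀ x : ℝ, |x - m| ≤ 1 → Real.exp (Δ / 2 * (σ * (x - m))) ≤
        1 + Δ / 2 * (σ * (x - m)) + Δ ^ 2 / 4 := by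
      intro x hx
      have h1 : |Δ / 2 * (σ * (x - m))| ≤ 1 := by
        rw [abs_mul, abs_mul, hσa, one_mul, abs_of_pos (by linarith : (0 : ℝ) < Δ / 2)]
        nlinarith [abs_nonneg (x - m)]
      refine (exp_le_one_add_add_sq h1).trans ?_
      have h2 : (x - m) ^ 2 ≤ 1 := by
        rw [← sq_abs]
        nlinarith [abs_nonneg (x - m)]
      have h3 : (Δ / 2 * (σ * (x - m))) ^ 2 = Δ ^ 2 / 4 * (x - m) ^ 2 := by
        rw [mul_pow, mul_pow, hσ2]
        ring
      rw [h3]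
      nlinarith [sq_nonneg Δ]
    have hT := hb 1 (abs_le.2 ⟨by linarith, by linarith⟩)
    have hF := hb 0 (abs_le.2 ⟨by linarith, by linarith⟩)
    simp only [Bool.toNat_true, Bool.toNat_false, Nat.cast_one, Nat.cast_zero]
    have hw : 0 < S.weight P (Δ / 2) m u := Real.exp_pos _
    have hx : P.mu u * (Real.exp (Δ / 2 * (σ * (1 - m))) - 1) +
        (1 - P.mu u) * (Real.exp (Δ / 2 * (σ * (0 - m))) - 1) ≤ -(Δ ^ 2 / 4) := by
      have t1 := mul_le_mul_of_nonneg_left hT (P.mu_nonneg u)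
      have t2 := mul_le_mul_of_nonneg_left hF (sub_nonneg.2 (P.mu_le_one u))
      have t3 := mul_le_mul_of_nonneg_left hσm hΔ.le
      nlinarith
    have := mul_le_mul_of_nonneg_left hx hw.le
    linarith
  rw [stepMean]
  simp only [hu]
  rw [← Finset.mul_sum]
  refine (mul_le_mul_of_nonneg_left (Finset.sum_le_sum fun u _ => hmul u)
    (inv_nonneg.2 hN.le)).trans (le_of_eq ?_)
  rw [Finset.sum_sub_distrib, ← Finset.mul_sum, ← Samples.potential]
  simp
  field_simp

/-- A threshold that separates the best service rate from the others. -/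
theorem Problem.exists_threshold (P : Problem N) (h : 0 < P.mu P.best) :
    ∃ m Δ : ℝ, 0 < Δ ∧ Δ ≤ 1 ∧ 0 ≤ m ∧ m ≤ 1 ∧
      m + Δ ≤ P.mu P.best ∧ ∀ i, i ≠ P.best → P.mu i ≤ m - Δ := by
  have : Nonempty (Fin N) := ⟨P.best⟩
  -- Counting the best server as 0 gives the runner-up rate c, with c ≥ 0; m is the midpoint of c
  -- and μ*.
  obtain ⟨j, hj⟩ := Finite.exists_max fun i => if i = P.best then 0 else P.mu i
  set c : ℝ := if j = P.best then 0 else P.mu j with hc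
  have hc0 : 0 ≤ c := by simpa using hj P.best
  have hc1 : c < P.mu P.best := by
    rw [hc]
    split_ifs with hb
    · exact h
    · exact P.mu_lt_best j hb
  have h1 := P.mu_le_one P.best
  refine ⟨(P.mu P.best + c) / 2, (P.mu P.best - c) / 2, by linarith, by linarith, by linarith,
    by linarith, by linarith, fun i hi => ?_⟩
  have := hj i
  simp only [hi, if_false] at this
  linarith

/-! ## Exploration slots -/

/-- Tail sums act as a prepaid budget: at time n the amount f n is released and G (n+1) is kept. -/
theorem exists_tail {f : ℕ → ℝ} (hf : ∀ n, 0 ≤ f n) (hs : Summable f) :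
    ∃ G : ℕ → ℝ, (∀ n, 0 ≤ G n) ∧ ∀ n, G n = f n + G (n + 1) := by
  refine ⟨fun n => ∑' j, f (j + n), fun n => tsum_nonneg fun j => hf _, fun n => ?_⟩
  change ∑' j, f (j + n) = f n + ∑' j, f (j + (n + 1))
  rw [((summable_nat_add_iff n).2 hs).tsum_eq_zero_add, zero_add]
  congr 1
  exact tsum_congr fun j => by rw [add_right_comm, add_assoc]

open Classical in
theorem explorationCount_succ (E : Set ℕ) (n : ℕ) :
    explorationCount E (n + 1) = explorationCount E n + if n ∈ E then 1 else 0 := by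
  have hf : {m | m < n ∧ m ∈ E}.Finite := (Set.finite_lt_nat n).subset fun m hm => hm.1
  unfold explorationCount
  split_ifs with h
  · have e : {m | m < n + 1 ∧ m ∈ E} = insert n {m | m < n ∧ m ∈ E} := by
      ext m
      simp only [Set.mem_ofPred_eq, Set.mem_insert_iff]
      constructor
      · rintro ⟨h1, h2⟩
        rcases Nat.lt_succ_iff_lt_or_eq.1 h1 with h3 | h3
        · exact Or.inr ⟨h3, h2⟩
        · exact Or.inl h3
      · rintro (rfl | ⟨h1, h2⟩)
        · exact ⟨Nat.lt_succ_self _, h⟩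
        · exact ⟨h1.trans (Nat.lt_succ_self _), h2⟩
    rw [e, Set.ncard_insert_of_notMem (by simp) hf]
  · have e : {m | m < n + 1 ∧ m ∈ E} = {m | m < n ∧ m ∈ E} := by
      ext m
      simp only [Set.mem_ofPred_eq]
      refine ⟨fun ⟨h1, h2⟩ => ⟨lt_of_le_of_ne (Nat.lt_succ_iff.1 h1) ?_, h2⟩,
        fun ⟨h1, h2⟩ => ⟨h1.trans (Nat.lt_succ_self _), h2⟩⟩
      rintro rfl
      exact h h2
    rw [e, add_zero]

theorem explorationCount_zero (E : Set ℕ) : explorationCount E 0 = 0 := by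
  simp [explorationCount]

/-- Exploring just before each positive perfect square gives V(n) = ⌊√n⌋, so ε = 1/2. -/
theorem exists_isSublinearExploration : ∃ E : Set ℕ, IsSublinearExploration E := by
  classical
  let E : Set ℕ := {m | Nat.sqrt (m + 1) = Nat.sqrt m + 1}
  have hV : ∀ n, explorationCount E n = Nat.sqrt n := by
    intro n
    induction n with
    | zero => simp [explorationCount_zero]
    | succ n ih =>
      rw [explorationCount_succ, ih]
      split_ifs with h
      · exact h.symm
      · have h1 : Nat.sqrt n ≤ Nat.sqrt (n + 1) := Nat.sqrt_le_sqrt n.le_succ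
        have h2 : Nat.sqrt (n + 1) ≤ Nat.sqrt n + 1 := Nat.sqrt_succ_le_succ_sqrt n
        have h3 : Nat.sqrt (n + 1) ≠ Nat.sqrt n + 1 := h
        omega
  refine ⟨E, 1, 1 / 2, 1, 1, one_pos, by norm_num, by norm_num, one_pos, one_pos, fun n => ?_⟩
  rw [hV, one_mul, ← Real.sqrt_eq_rpow]
  have h1 := Real.nat_sqrt_le_real_sqrt (a := n)
  have h2 := Real.real_sqrt_le_nat_sqrt_succ (a := n)
  constructor <;> linarith

/-- Because ε < 1, exploration takes an arbitrarily small fraction of the slots, so it cannot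
destroy the negative drift of the queue. -/
theorem IsSublinearExploration.exists_count_le {E : Set ℕ} (hE : IsSublinearExploration E) {c : ℝ}
    (hc : 0 < c) : ∃ C : ℝ, 0 ≤ C ∧ ∀ n, (explorationCount E n : ℝ) ≤ c * n + C := by
  obtain ⟨r, ε, b₁, b₂, hr, h0, h1, hb₁, hb₂, h⟩ := hE
  have hb := ((tendsto_rpow_neg_atTop (sub_pos.2 h1)).comp
    tendsto_natCast_atTop_atTop).eventually_lt_const (div_pos hc hr)
  obtain ⟨n₀, hn₀⟩ := Filter.eventually_atTop.1 hb
  refine ⟨n₀ + b₂, by positivity, fun n => ?_⟩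
  rcases le_total n₀ n with hn | hn
  · have h2 : r * (n : ℝ) ^ ε ≤ c * n := by
      rcases Nat.eq_zero_or_pos n with rfl | hpos
      · simp [Real.zero_rpow h0.ne']
      have hp : (0 : ℝ) < n := by exact_mod_cast hpos
      have h3 := (lt_div_iff₀ hr).1 (hn₀ n hn)
      simp only [Function.comp_apply] at h3
      have h4 : (n : ℝ) ^ ε = (n : ℝ) ^ (-(1 - ε)) * n := by
        rw [← Real.rpow_add_one hp.ne']
        congr 1
        ring
      rw [h4]
      have := mul_le_mul_of_nonneg_right h3.le hp.le
      linarith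
    have := (h n).2
    have : (0 : ℝ) ≤ n₀ := Nat.cast_nonneg _
    linarith
  · have h3 : explorationCount E n ≤ n := by
      have : explorationCount E n ≤ (Set.Iio n).ncard :=
        Set.ncard_le_ncard (fun m hm => hm.1) (Set.finite_Iio n)
      simpa using this
    have h4 : (explorationCount E n : ℝ) ≤ n₀ := by exact_mod_cast h3.trans hn
    have : 0 ≤ c * n := by positivity
    linarith

theorem IsSublinearExploration.summable {E : Set ℕ} (hE : IsSublinearExploration E) {ρ : ℝ}
    (h0 : 0 < ρ) (h1 : ρ < 1) :
    Summable fun m : ℕ => ((m : ℝ) + 1) * ρ ^ explorationCount E m := by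
  obtain ⟨r, ε, b₁, b₂, hr, hε, -, hb₁, -, h⟩ := hE
  have ha : 0 < -Real.log ρ * r := mul_pos (neg_pos.2 (Real.log_neg h0 h1)) hr
  -- The exponent -3/ε becomes m^(-3) after substituting m^ε; the factor m+1 ≤ 2m then leaves the
  -- summable m^(-2).
  have ho := ((isLittleO_exp_neg_mul_rpow_atTop ha (-3 / ε)).comp_tendsto
    (tendsto_rpow_atTop hε)).comp_tendsto tendsto_natCast_atTop_atTop
  have hb := ho.bound one_pos
  have hs : Summable fun m : ℕ => 2 * Real.exp (-Real.log ρ * b₁) * (m : ℝ) ^ (-2 : ℝ) :=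
    (Real.summable_nat_rpow.2 (by norm_num)).mul_left _
  refine Summable.of_norm_bounded_eventually_nat hs ?_
  filter_upwards [hb, Filter.eventually_ge_atTop 1] with m hm hm1
  have hm0 : (1 : ℝ) ≤ m := by exact_mod_cast hm1
  have hmp : (0 : ℝ) < m := by linarith
  simp only [Function.comp_apply, one_mul] at hm
  rw [Real.norm_of_nonneg (by positivity), Real.norm_of_nonneg (by positivity),
    ← Real.rpow_mul hmp.le, mul_div_cancel₀ _ hε.ne'] at hm
  rw [Real.norm_of_nonneg (by positivity)]
  have e1 : ρ ^ explorationCount E m ≤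
      Real.exp (-Real.log ρ * b₁) * Real.exp (-(-Real.log ρ * r) * (m : ℝ) ^ ε) := by
    rw [← Real.rpow_natCast, Real.rpow_def_of_pos h0, ← Real.exp_add]
    refine Real.exp_le_exp.2 ?_
    have := mul_le_mul_of_nonneg_left (h m).1 (neg_pos.2 (Real.log_neg h0 h1)).le
    linarith
  have e2 : (m : ℝ) ^ (-2 : ℝ) = m * (m : ℝ) ^ (-3 : ℝ) := by
    rw [← Real.rpow_one_add' hmp.le (by norm_num)]
    norm_num
  rw [e2]
  calc ((m : ℝ) + 1) * ρ ^ explorationCount E m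
      ≤ (2 * m) * (Real.exp (-Real.log ρ * b₁) * (m : ℝ) ^ (-3 : ℝ)) := by
        refine mul_le_mul (by linarith) (e1.trans ?_) (by positivity) (by positivity)
        exact mul_le_mul_of_nonneg_left hm (Real.exp_pos _).le
    _ = _ := by ring

/-! ## The learning subroutine -/

open Classical in
/-- The decision of the learning subroutine in its slot `n`. -/
def learnDecide (E : Set ℕ) (sel : (Fin N → ℝ) → Fin N) [Nonempty (Fin N)] (n : ℕ)
    (S : Samples N) : PMF (Fin N) :=
  if n ∈ E then PMF.uniformOfFintype (Fin N) else PMF.pure (sel S.mean)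

open Classical in
/-- The samples of the learning subroutine after its slot `n`. -/
def learnUpdate (E : Set ℕ) (n : ℕ) (S : Samples N) (o : Obs N) : Samples N :=
  if n ∈ E then S.update o.2.2 o.2.1 else S

set_option maxHeartbeats 400000 in
/-- A Lyapunov function for the learning subroutine, uniformly in the period number `p`. -/
theorem exists_learn_lyapunov [Nonempty (Fin N)] (P : Problem N) (hP : P.lam < P.mu P.best)
    {E : Set ℕ} (hE : IsSublinearExploration E) (sel : (Fin N → ℝ) → Fin N)
    (Φ : Samples N → ℝ) {ρ : ℝ} (hρ0 : 0 < ρ) (hρ1 : ρ < 1) (hΦ : ∀ S, 0 ≤ Φ S)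
    (hΦsel : ∀ S : Samples N, S.Valid → sel S.mean ≠ P.best → 1 ≤ Φ S)
    (hΦstep : ∀ S : Samples N, stepMean P (PMF.uniformOfFintype (Fin N))
      (fun o => Φ (S.update o.2.2 o.2.1)) ≤ ρ * Φ S) :
    ∃ W : ℕ → ℕ → ℕ → Samples N → ℝ, (∀ p n q S, 0 ≤ W p n q S) ∧
      (∃ C : ℝ, 0 ≤ C ∧ ∀ p q, q ≤ p + 1 → W p 0 q (Samples.empty N) ≤ C * ((p : ℝ) + 1) ^ 2) ∧
      ∀ p n q S, q ≠ 0 → q ≤ p + n + 1 → S.Valid →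
        stepMean P (learnDecide E sel n S) (fun o =>
          W p (n + 1) ((q - o.2.1.toNat) + o.1.toNat) (learnUpdate E n S o)) +
          q * (1 - (learnDecide E sel n S P.best).toReal) ≤ W p n q S := by
  set δ := P.mu P.best - P.lam with hδ
  have hδ0 : 0 < δ := by linarith
  have hδ1 : δ ≤ 1 := by linarith [P.mu_le_one P.best, P.lam_pos]
  -- The rate δ/4 makes 2V(n) ≤ δn/2 + 2C₀, which is what gives L ≥ q below.
  obtain ⟨C₀, hC₀, hV⟩ := hE.exists_count_le (c := δ / 4) (by linarith)
  obtain ⟨G, hG0, hG⟩ := exists_tail (f := fun m : ℕ => ((m : ℝ) + 1) * ρ ^ explorationCount E m)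
    (fun n => by positivity) (hE.summable hρ0 hρ1)
  set V : ℕ → ℕ := explorationCount E with hVdef
  set α : ℝ := δ⁻¹ with hα
  have hα0 : 0 < α := inv_pos.2 hδ0
  have hαδ : α * δ = 1 := inv_mul_cancel₀ hδ0.ne'
  -- Under drift -δ/2, the term αL² contributes -αδL = -L, which pays the wrong backlog, and βL
  -- contributes -βδ/2 = -9α, which cancels the second-order term of the square.
  set β : ℝ := 18 * α ^ 2 with hβ
  have hβ0 : 0 < β := by positivity
  have hβδ : β * δ = 18 * α := by rw [hβ]; linear_combination 18 * α * hαδ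
  set c : ℝ := α * (4 * (2 + 2 * C₀) + 9) + 2 * β + 1 with hc
  have hc0 : 0 < c := by positivity
  -- The compensator gives back δ/2 per slot and takes 2 per exploration. The drift of L is then at
  -- most -δ/2 both when exploring and when serving i*.
  let L : ℕ → ℕ → ℝ := fun n q => q + (δ / 2 * n - 2 * V n + 2 * C₀)
  have hL : ∀ n q : ℕ, (q : ℝ) ≤ L n q := fun n q => by
    have := hV n
    simp only [L]
    linarith
  have hL0 : ∀ n q, 0 ≤ L n q := fun n q => (Nat.cast_nonneg q).trans (hL n q)
  -- Here G n / ρ^{V(n)} is ∑_{m≥n} (m+1) ρ^{V(m)-V(n)}: the future exploitation costs, discounted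
  -- by the explorations still to come before slot m.
  let A : ℕ → ℕ → ℝ := fun p n => c * (p + 1) * (G n / ρ ^ V n)
  have hA0 : ∀ p n, 0 ≤ A p n := fun p n => by
    have := hG0 n
    positivity
  refine ⟨fun p n q S => (α * L n q ^ 2 + β * L n q) + A p n * Φ S, ?_, ?_, ?_⟩
  · intro p n q S
    have := hL0 n q
    have := hA0 p n
    have := hΦ S
    positivity
  · refine ⟨α * (1 + 2 * C₀) ^ 2 + β * (1 + 2 * C₀) + c * G 0 * Φ (Samples.empty N), ?_,
      fun p q hq => ?_⟩
    · have := hG0 0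
      have := hΦ (Samples.empty N)
      positivity
    · have hq' : (q : ℝ) ≤ p + 1 := by exact_mod_cast hq
      have hp : (1 : ℝ) ≤ p + 1 := by linarith [Nat.cast_nonneg (α := ℝ) p]
      have hVz : V 0 = 0 := explorationCount_zero E
      have h1 : L 0 q ≤ (1 + 2 * C₀) * (p + 1) := by
        simp only [L, hVz, Nat.cast_zero]
        nlinarith
      have h2 : L 0 q ^ 2 ≤ (1 + 2 * C₀) ^ 2 * ((p : ℝ) + 1) ^ 2 := by
        rw [← mul_pow]
        exact pow_le_pow_left₀ (hL0 0 q) h1 2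
      have h3 : (p : ℝ) + 1 ≤ ((p : ℝ) + 1) ^ 2 := by nlinarith
      have h4 : A p 0 = c * G 0 * (p + 1) := by
        simp only [A, hVz, pow_zero, div_one]
        ring
      have h5 : 0 ≤ c * G 0 * Φ (Samples.empty N) :=
        mul_nonneg (mul_nonneg hc0.le (hG0 0)) (hΦ _)
      have h6 := mul_le_mul_of_nonneg_left h3 h5
      have h7 := mul_le_mul_of_nonneg_left h2 hα0.le
      have h8 := mul_le_mul_of_nonneg_left h1 hβ0.le
      have h9 := mul_le_mul_of_nonneg_left h3 (by positivity : 0 ≤ β * (1 + 2 * C₀))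
      dsimp only
      rw [h4]
      linarith
  intro p n q S hq hqn hS
  set w := learnDecide E sel n S with hw
  rw [stepMean_add, stepMean_const_mul]
  have hGA : A p n = c * (p + 1) * ((n + 1) + G (n + 1) / ρ ^ V n) := by
    have : G n / ρ ^ V n = (n + 1) + G (n + 1) / ρ ^ V n := by
      rw [hG n]
      field_simp
    simp only [A]
    rw [this]
  -- Δ is the increment of the compensator and κ bounds the drift of L. A step of L has size at most
  -- 3, whence 9α.
  have hdrift : ∀ Δ κ : ℝ, |Δ| ≤ 2 → V (n + 1) = V n + (δ / 2 - Δ) / 2 →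
      P.lam - ∑ u, (w u).toReal * P.mu u + Δ ≤ κ →
      stepMean P w (fun o => α * L (n + 1) ((q - o.2.1.toNat) + o.1.toNat) ^ 2 +
        β * L (n + 1) ((q - o.2.1.toNat) + o.1.toNat))
      ≤ α * L n q ^ 2 + β * L n q + 9 * α + (2 * α * L n q + β) * κ := by
    intro Δ κ hΔ hVn hκ
    have hx : ∀ o : Obs N, L (n + 1) ((q - o.2.1.toNat) + o.1.toNat)
        = L n q + (((o.1.toNat : ℝ) - o.2.1.toNat) + Δ) := by
      intro o
      simp only [L]
      rw [cast_backlog_step hq, hVn]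
      push_cast
      ring
    simp only [hx]
    have hpt : ∀ o : Obs N, α * (L n q + (((o.1.toNat : ℝ) - o.2.1.toNat) + Δ)) ^ 2 +
        β * (L n q + (((o.1.toNat : ℝ) - o.2.1.toNat) + Δ))
        ≤ (α * L n q ^ 2 + β * L n q + 9 * α + (2 * α * L n q + β) * Δ) +
          (2 * α * L n q + β) * ((o.1.toNat : ℝ) - o.2.1.toNat) := by
      intro o
      have ha : (o.1.toNat : ℝ) ≤ 1 := by exact_mod_cast Bool.toNat_le o.1
      have hd : (o.2.1.toNat : ℝ) ≤ 1 := by exact_mod_cast Bool.toNat_le o.2.1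
      have ha0 : (0 : ℝ) ≤ o.1.toNat := Nat.cast_nonneg _
      have hd0 : (0 : ℝ) ≤ o.2.1.toNat := Nat.cast_nonneg _
      obtain ⟨hΔ1, hΔ2⟩ := abs_le.1 hΔ
      have hsq : (((o.1.toNat : ℝ) - o.2.1.toNat) + Δ) ^ 2 ≤ 9 := by
        have := sq_le_sq' (a := ((o.1.toNat : ℝ) - o.2.1.toNat) + Δ) (b := 3)
          (by linarith) (by linarith)
        linarith
      have := mul_le_mul_of_nonneg_left hsq hα0.le
      linarith
    refine (stepMean_mono P w hpt).trans ?_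
    rw [stepMean_add, stepMean_const, stepMean_const_mul, stepMean_arrival_sub_service]
    have := mul_le_mul_of_nonneg_left hκ
      (by have := hL0 n q; positivity : 0 ≤ 2 * α * L n q + β)
    linarith
  have hserv : 0 ≤ ∑ u, (w u).toReal * P.mu u :=
    Finset.sum_nonneg fun u _ => mul_nonneg ENNReal.toReal_nonneg (P.mu_nonneg u)
  have hΦS := hΦ S
  have hqL := hL n q
  have hG1 := hG0 (n + 1)
  have hwrong : (q : ℝ) * (1 - (w P.best).toReal) ≤ q :=
    mul_le_of_le_one_right (Nat.cast_nonneg _)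
      (by linarith [ENNReal.toReal_nonneg (a := w P.best)])
  by_cases hnE : n ∈ E
  · have hV1 : V (n + 1) = V n + 1 := by
      rw [hVdef, explorationCount_succ, if_pos hnE]
    have h1 := hdrift (δ / 2 - 2) (-(δ / 2)) (abs_le.2 ⟨by linarith, by linarith⟩)
      (by rw [hV1]; push_cast; ring) (by linarith [P.lam_le_one])
    have h2 : stepMean P w (fun o => Φ (learnUpdate E n S o)) ≤ ρ * Φ S := by
      rw [hw]
      simp only [learnDecide, learnUpdate, if_pos hnE]
      exact hΦstep S
    have h3 := mul_le_mul_of_nonneg_left h2 (hA0 p (n + 1))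
    have h4 : A p (n + 1) * (ρ * Φ S) = c * (p + 1) * (G (n + 1) / ρ ^ V n) * Φ S := by
      simp only [A]
      rw [hV1, pow_succ]
      field_simp
    have h5 : 0 ≤ c * (p + 1) * (n + 1) * Φ S := by positivity
    rw [h4] at h3
    dsimp only
    rw [hGA]
    have h6 : (2 * α * L n q + β) * -(δ / 2) = -L n q - 9 * α := by
      linear_combination (-L n q) * hαδ - 1 / 2 * hβδ
    rw [h6] at h1
    linarith
  · have hV1 : V (n + 1) = V n := by
      rw [hVdef, explorationCount_succ, if_neg hnE, add_zero]
    have h2 : stepMean P w (fun o => Φ (learnUpdate E n S o)) = Φ S := by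
      simp only [learnUpdate, if_neg hnE]
      exact stepMean_const _ _ _
    have hA1 : A p (n + 1) = c * (p + 1) * (G (n + 1) / ρ ^ V n) := by
      simp only [A]
      rw [hV1]
    have hw' : w = PMF.pure (sel S.mean) := by
      rw [hw]
      simp only [learnDecide, if_neg hnE]
    dsimp only
    rw [h2, hA1, hGA]
    have h5 : 0 ≤ c * (p + 1) * (n + 1) * Φ S := by positivity
    by_cases hsel : sel S.mean = P.best
    · have hsum : ∑ u, (w u).toReal * P.mu u = P.mu P.best := by
        rw [hw', hsel, sum_pure_mul]
      have hz : (w P.best).toReal = 1 := by simp [hw', hsel]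
      have h1 := hdrift (δ / 2) (-(δ / 2)) (abs_le.2 ⟨by linarith, by linarith⟩)
        (by rw [hV1]; ring) (by rw [hsum]; linarith)
      have h6 : (2 * α * L n q + β) * -(δ / 2) = -L n q - 9 * α := by
        linear_combination (-L n q) * hαδ - 1 / 2 * hβδ
      rw [h6] at h1
      rw [hz, sub_self, mul_zero]
      linarith [hL0 n q]
    -- Exploiting a wrong server may push L upwards. The loss 4αL + 9α + 2β + q is at most
    -- c(p+1)(n+1), by the choice of c, and the budget A releases exactly that times Φ ≥ 1.
    · have h1 := hdrift (δ / 2) 2 (abs_le.2 ⟨by linarith, by linarith⟩)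
        (by rw [hV1]; ring) (by linarith [P.lam_le_one])
      have hone := hΦsel S hS hsel
      have hpn : (1 : ℝ) ≤ (p + 1) * (n + 1) := by
        rw [← Nat.cast_add_one, ← Nat.cast_add_one, ← Nat.cast_mul]
        exact_mod_cast Nat.one_le_iff_ne_zero.2 (by positivity)
      set X : ℝ := ((p : ℝ) + 1) * (n + 1) with hX
      have hpnn := mul_nonneg (Nat.cast_nonneg (α := ℝ) p) (Nat.cast_nonneg (α := ℝ) n)
      have hqX : (q : ℝ) ≤ X := by
        have : (q : ℝ) ≤ p + n + 1 := by exact_mod_cast hqn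
        rw [hX]; linarith
      have hnX : (n : ℝ) ≤ X := by
        rw [hX]; linarith [Nat.cast_nonneg (α := ℝ) p]
      have hLX : L n q ≤ (2 + 2 * C₀) * X := by
        have h7 : (0 : ℝ) ≤ V n := Nat.cast_nonneg _
        have h8 : δ / 2 * n ≤ n :=
          mul_le_of_le_one_left (Nat.cast_nonneg _) (by linarith)
        have h9 := mul_le_mul_of_nonneg_left hpn hC₀
        simp only [L]
        linarith
      have hcX : 4 * (α * L n q) + 9 * α + 2 * β + q ≤ c * X := by
        have t1 := mul_le_mul_of_nonneg_left hLX hα0.le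
        have t2 := mul_le_mul_of_nonneg_left hpn hα0.le
        have t3 := mul_le_mul_of_nonneg_left hpn hβ0.le
        rw [hc]
        linarith
      have hfin : c * X ≤ c * X * Φ S :=
        le_mul_of_one_le_right (by positivity) hone
      have e : c * (p + 1) * ((n + 1) + G (n + 1) / ρ ^ V n) * Φ S
          = c * X * Φ S + c * (p + 1) * (G (n + 1) / ρ ^ V n) * Φ S := by
        rw [hX]; ring
      rw [e]
      linarith

/-! ## The policy `π₃` has bounded regret -/

/-- While i* serves a nonempty queue the drift is -δ, so the exponential contracts by 1 - δ²/2 +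
δ²/4. This makes long busy periods exponentially unlikely. -/
theorem stepMean_best_exp (P : Problem N) {δ : ℝ} (hδ : δ = P.mu P.best - P.lam) (hδ0 : 0 ≤ δ)
    (hδ1 : δ ≤ 1) {q : ℕ} (hq : q ≠ 0) :
    stepMean P (PMF.pure P.best)
      (fun o => Real.exp (δ / 2 * ((q - o.2.1.toNat) + o.1.toNat : ℕ)))
      ≤ (1 - δ ^ 2 / 4) * Real.exp (δ / 2 * q) := by
  have hpt : ∀ o : Obs N, Real.exp (δ / 2 * ((q - o.2.1.toNat) + o.1.toNat : ℕ))
      ≤ Real.exp (δ / 2 * q) *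
        ((1 + δ ^ 2 / 4) + δ / 2 * ((o.1.toNat : ℝ) - o.2.1.toNat)) := by
    intro o
    rw [cast_backlog_step hq, mul_add, Real.exp_add]
    refine mul_le_mul_of_nonneg_left ?_ (Real.exp_pos _).le
    have ha : (o.1.toNat : ℝ) ≤ 1 := by exact_mod_cast Bool.toNat_le o.1
    have hd : (o.2.1.toNat : ℝ) ≤ 1 := by exact_mod_cast Bool.toNat_le o.2.1
    have ha0 : (0 : ℝ) ≤ o.1.toNat := Nat.cast_nonneg _
    have hd0 : (0 : ℝ) ≤ o.2.1.toNat := Nat.cast_nonneg _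
    have h1 : |(o.1.toNat : ℝ) - o.2.1.toNat| ≤ 1 := abs_le.2 ⟨by linarith, by linarith⟩
    have h2 : |δ / 2 * ((o.1.toNat : ℝ) - o.2.1.toNat)| ≤ 1 := by
      rw [abs_mul, abs_of_nonneg (by linarith : 0 ≤ δ / 2)]
      nlinarith [abs_nonneg ((o.1.toNat : ℝ) - o.2.1.toNat)]
    refine (exp_le_one_add_add_sq h2).trans ?_
    have h3 : ((o.1.toNat : ℝ) - o.2.1.toNat) ^ 2 ≤ 1 := (sq_le_one_iff_abs_le_one _).2 h1
    rw [mul_pow]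
    nlinarith [sq_nonneg δ]
  refine (stepMean_mono P _ hpt).trans (le_of_eq ?_)
  rw [stepMean_const_mul, stepMean_add, stepMean_const, stepMean_const_mul,
    stepMean_arrival_sub_service, sum_pure_mul, hδ]
  ring

theorem summable_sq_mul_pow {r : ℝ} (h0 : 0 < r) (h1 : r < 1) :
    Summable fun p : ℕ => ((p : ℝ) + 1) ^ 2 * r ^ p := by
  have hs : Summable fun p : ℕ => (p : ℝ) ^ 2 * r ^ p :=
    summable_pow_mul_geometric_of_norm_lt_one 2 (by rwa [Real.norm_of_nonneg h0.le])
  have h := (summable_nat_add_iff (f := fun p : ℕ => (p : ℝ) ^ 2 * r ^ p) 1).2 hs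
  refine (h.mul_right r⁻¹).congr fun p => ?_
  push_cast
  rw [pow_succ r p]
  field_simp

/-- The invariants of the variables of `π₃`. -/
structure State.Inv (s : State N) : Prop where
  one_le_period : 1 ≤ s.period
  outer_valid : s.outer.Valid
  inner_valid : s.inner.Valid
  queue_le : s.queue ≠ 0 → s.queue ≤ s.age + 1
  inner_eq : s.queue ≠ 0 → s.age ≤ s.period → s.inner = Samples.empty N

theorem State.inv_init : (State.init N).Inv :=
  ⟨le_rfl, Samples.valid_empty, Samples.valid_empty, fun h => absurd rfl h,
    fun h => absurd rfl h⟩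

/-- A busy period opens with backlog 1 and gains at most one customer per slot. Inner samples are
cleared in empty slots and untouched before age p, so the subroutine starts afresh. -/
theorem State.Inv.step (E : Set ℕ) {s : State N} (hs : s.Inv) (o : Obs N) : (s.step E o).Inv := by
  have ha := Bool.toNat_le o.1
  obtain ⟨h1, h2, h3, h4, h5⟩ := hs
  by_cases hq : s.queue = 0
  · simp only [State.step, hq, if_true]
    refine ⟨h1, ?_, Samples.valid_empty, fun _ => ?_, fun _ _ => rfl⟩
    · dsimp only
      split_ifs
      · exact h2.update _ _
      · exact h2
    · dsimp only
      omega
  · simp only [State.step, hq, if_false]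
    refine ⟨?_, h2, ?_, fun h => ?_, fun h h' => ?_⟩
    · dsimp only
      split_ifs <;> omega
    · dsimp only
      split_ifs
      · exact h3.update _ _
      · exact h3
    · dsimp only at h ⊢
      rw [if_neg h]
      have := h4 hq
      omega
    · dsimp only at h h' ⊢
      rw [if_neg h, if_neg h] at h'
      rw [if_neg (by omega)]
      exact h5 hq (by omega)

theorem hasBoundedRegret_piThree {E : Set ℕ} {sel : (Fin N → ℝ) → Fin N} (idle : Fin N)
    (hE : IsSublinearExploration E) (hsel : IsArgmax sel) (P : Problem N)
    (hP : P.lam < P.mu P.best) : HasBoundedRegret (piThree E sel idle) P := by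
  classical
  have : Nonempty (Fin N) := ⟨idle⟩
  obtain ⟨m, Δ, hΔ0, hΔ1, hm0, hm1, hbest, hother⟩ :=
    P.exists_threshold (P.lam_pos.trans hP)
  have hN : (1 : ℝ) ≤ N := by
    exact_mod_cast Fin.pos_iff_nonempty.2 inferInstance
  set Φ : Samples N → ℝ := fun S => S.potential P (Δ / 2) m
  set ρ : ℝ := 1 - Δ ^ 2 / (4 * N) with hρ
  have hfrac : 0 < Δ ^ 2 / (4 * N) ∧ Δ ^ 2 / (4 * N) < 1 := by
    refine ⟨by positivity, (div_lt_one (by positivity)).2 ?_⟩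
    nlinarith
  have hρ0 : 0 < ρ := by linarith [hfrac.2]
  have hρ1 : ρ < 1 := by linarith [hfrac.1]
  have hΦ : ∀ S, 0 ≤ Φ S := fun S => S.potential_nonneg P _ _
  have hΦsel : ∀ S : Samples N, S.Valid → sel S.mean ≠ P.best → 1 ≤ Φ S := fun S hS hj =>
    Samples.one_le_potential P (by linarith) hm0 hS hj (hsel S.mean P.best)
  have hΦstep : ∀ S : Samples N, stepMean P (PMF.uniformOfFintype (Fin N))
      (fun o => Φ (S.update o.2.2 o.2.1)) ≤ ρ * Φ S := fun S =>
    stepMean_uniform_potential P hΔ0 hΔ1 hm0 hm1 hbest hother S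
  obtain ⟨L, hL0, ⟨C, hC0, hLC⟩, hL⟩ :=
    exists_learn_lyapunov P hP hE sel Φ hρ0 hρ1 hΦ hΦsel hΦstep
  obtain ⟨δ, hδ⟩ : ∃ δ, δ = P.mu P.best - P.lam := ⟨_, rfl⟩
  have hδ0 : 0 < δ := by linarith
  have hδ1 : δ ≤ 1 := by linarith [P.mu_le_one P.best, P.lam_pos]
  set ν : ℝ := 1 - δ ^ 2 / 4 with hν
  have hν0 : 0 < ν := by rw [hν]; nlinarith
  have hν1 : ν < 1 := by rw [hν]; nlinarith
  -- G budgets for busy periods in which i* serves but the queue does not empty in time, H for those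
  -- with a wrong estimate. The extra factor ρ in H accounts for the exploration that opens each
  -- empty period.
  obtain ⟨G, hG0, hG⟩ := exists_tail (fun p => by positivity) (summable_sq_mul_pow hν0 hν1)
  obtain ⟨H, hH0, hH⟩ := exists_tail (fun p => by positivity)
    ((summable_sq_mul_pow hρ0 hρ1).mul_left ρ)
  -- the value at the start of empty period `p`
  let F : ℕ → Samples N → ℝ := fun p S =>
    C * Real.exp (δ / 2) * G p + (C + 1) * (H p / ρ ^ p) * Φ S
  have hF0 : ∀ p S, 0 ≤ F p S := fun p S => by
    have := hG0 p
    have := hH0 p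
    have := hΦ S
    positivity
  -- the value in the remaining slots of empty period `p`
  let I : ℕ → Samples N → ℝ := fun p S =>
    C * ((p : ℝ) + 1) ^ 2 * Real.exp (δ / 2) * ν ^ p + (C + 1) * ((p : ℝ) + 1) ^ 2 * Φ S +
      F (p + 1) S
  have hI0 : ∀ p S, 0 ≤ I p S := fun p S => by
    have := hF0 (p + 1) S
    have := hΦ S
    positivity
  have hFI : ∀ p S, stepMean P (PMF.uniformOfFintype (Fin N))
      (fun o => I p (S.update o.2.2 o.2.1)) ≤ F p S := by
    intro p S
    have e : ∀ S, I p S = (C * Real.exp (δ / 2) * G p) +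
        (C + 1) * (((p : ℝ) + 1) ^ 2 + H (p + 1) / ρ ^ (p + 1)) * Φ S := by
      intro S
      simp only [I, F]
      rw [hG p]
      ring
    simp only [e]
    rw [stepMean_add, stepMean_const, stepMean_const_mul]
    refine add_le_add_right ?_ _
    have hc : 0 ≤ (C + 1) * (((p : ℝ) + 1) ^ 2 + H (p + 1) / ρ ^ (p + 1)) := by
      have := hH0 (p + 1)
      positivity
    refine (mul_le_mul_of_nonneg_left (hΦstep S) hc).trans (le_of_eq ?_)
    rw [hH p]
    field_simp
    ring
  -- the value in the first slots of busy period `p`, without the future periods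
  let B : ℕ → ℕ → ℕ → Samples N → ℝ := fun p k q S =>
    if sel S.mean = P.best then C * ((p : ℝ) + 1) ^ 2 * (ν ^ (p - k) * Real.exp (δ / 2 * q))
    else C * ((p : ℝ) + 1) ^ 2 + ((p - k : ℕ) : ℝ) * (p + 2)
  have hB0 : ∀ p k q S, 0 ≤ B p k q S := fun p k q S => by
    simp only [B]
    split_ifs <;> positivity
  have hBI : ∀ p (S : Samples N), S.Valid → B p 0 1 S + F (p + 1) S ≤ I p S := by
    intro p S hS
    have hΦS := hΦ S
    simp only [B, I, Nat.sub_zero, Nat.cast_one, mul_one]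
    split_ifs with h
    · have : 0 ≤ (C + 1) * ((p : ℝ) + 1) ^ 2 * Φ S := by positivity
      linarith
    -- The wrong-estimate cost is C(p+1)² + p(p+2) ≤ (C+1)(p+1)², which explains the coefficient C+1
    -- in front of Φ.
    · have h1 := hΦsel S hS h
      have h2 : (C + 1) * ((p : ℝ) + 1) ^ 2 * 1 ≤ (C + 1) * ((p : ℝ) + 1) ^ 2 * Φ S :=
        mul_le_mul_of_nonneg_left h1 (by positivity)
      have h3 : 0 ≤ C * ((p : ℝ) + 1) ^ 2 * Real.exp (δ / 2) * ν ^ p := by positivity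
      linarith
  have hBstep : ∀ p k q (S : Samples N), k < p → q ≠ 0 → q ≤ k + 1 →
      stepMean P (PMF.pure (sel S.mean))
        (fun o => B p (k + 1) ((q - o.2.1.toNat) + o.1.toNat) S) +
        q * (1 - (PMF.pure (sel S.mean) P.best).toReal) ≤ B p k q S := by
    intro p k q S hk hq hqk
    simp only [B]
    have hpk : p - k = p - (k + 1) + 1 := by omega
    split_ifs with h
    · rw [h, stepMean_const_mul, stepMean_const_mul, hpk, pow_succ ν]
      have h1 := mul_le_mul_of_nonneg_left (stepMean_best_exp P hδ hδ0.le hδ1 hq)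
        (by positivity : 0 ≤ C * ((p : ℝ) + 1) ^ 2 * ν ^ (p - (k + 1)))
      rw [← hν] at h1
      simp only [PMF.pure_apply, if_true, ENNReal.toReal_one, sub_self, mul_zero, add_zero]
      linarith
    -- The outer estimate is frozen throughout the busy period, so this branch of B is
    -- deterministic; it releases p+2 per slot, which covers q.
    · have hz : (PMF.pure (sel S.mean) P.best).toReal = 0 := by
        simp [PMF.pure_apply, Ne.symm h]
      rw [stepMean_const, hz, hpk]
      have : (q : ℝ) ≤ p + 2 := by exact_mod_cast (by omega : q ≤ p + 2)
      push_cast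
      linarith
  have hBL : ∀ p q (S : Samples N), q ≤ p + 1 → L p 0 q (Samples.empty N) ≤ B p p q S := by
    intro p q S hq
    refine (hLC p q hq).trans ?_
    simp only [B, Nat.sub_self, pow_zero, one_mul, Nat.cast_zero, zero_mul, add_zero]
    split_ifs
    · exact le_mul_of_one_le_right (by positivity) (Real.one_le_exp (by positivity))
    · exact le_rfl
  -- During a busy period W is the budget of that period plus the value F of the next empty period,
  -- whose outer samples are already known.
  let W : State N → ℝ := fun s =>
    if s.queue = 0 then if s.age = 0 then F s.period s.outer else I s.period s.outer
    else (if s.age < s.period then B s.period s.age s.queue s.outer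
      else L s.period (s.age - s.period) s.queue s.inner) + F (s.period + 1) s.outer
  refine hasBoundedRegret_of_sum_le _ P hP (W (State.init N)) fun T =>
    sum_wrongBacklog_le P E sel idle W State.Inv State.inv_init (fun s o hs => hs.step E o) ?_ ?_ T
  · intro s _
    simp only [W]
    split_ifs
    · exact hF0 _ _
    · exact hI0 _ _
    · exact add_nonneg (hB0 _ _ _ _) (hF0 _ _)
    · exact add_nonneg (hL0 _ _ _ _) (hF0 _ _)
  intro s hs
  by_cases hq : s.queue = 0
  · have hstep : ∀ o : Obs N, W (s.step E o) ≤
        I s.period (if s.age = 0 then s.outer.update o.2.2 o.2.1 else s.outer) := by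
      intro o
      have hv : (if s.age = 0 then s.outer.update o.2.2 o.2.1 else s.outer).Valid := by
        split_ifs
        · exact hs.outer_valid.update _ _
        · exact hs.outer_valid
      -- As p ≥ 1, an arrival in an empty slot leads to B at k = 0 and q = 1, not to the learning
      -- branch.
      have hp := hs.one_le_period
      simp only [State.step, hq, if_true, W, Nat.zero_sub, zero_add]
      cases o.1
      · simp
      · simpa [Nat.pos_iff_ne_zero.2 (Nat.one_le_iff_ne_zero.1 hp)] using hBI s.period _ hv
    refine (add_le_add_left (stepMean_mono P _ hstep) _).trans ?_
    simp only [hq, Nat.cast_zero, zero_mul, add_zero, W, if_true, State.decide]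
    split_ifs with hage
    · exact hFI _ _
    · exact (stepMean_const _ _ _).le
  by_cases hage : s.age < s.period
  · have hstep : ∀ o : Obs N, W (s.step E o) ≤
        B s.period (s.age + 1) ((s.queue - o.2.1.toNat) + o.1.toNat) s.outer +
          F (s.period + 1) s.outer := by
      intro o
      have ha := Bool.toNat_le o.1
      have hqa := hs.queue_le hq
      have hin := hs.inner_eq hq hage.le
      have hnot : ¬ (s.period ≤ s.age ∧ s.age - s.period ∈ E) := by omega
      simp only [State.step, hq, if_false, W, if_neg hnot, hin]
      by_cases h0 : (s.queue - o.2.1.toNat) + o.1.toNat = 0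
      · simp only [h0, if_true]
        exact le_add_of_nonneg_left (hB0 _ _ _ _)
      · simp only [h0, if_false]
        refine add_le_add_left ?_ _
        split_ifs with h1
        · exact le_rfl
        -- The handover to the subroutine: at k = p what remains of B covers the starting cost of
        -- the subroutine.
        · have h2 : s.period = s.age + 1 := by omega
          rw [← h2, Nat.sub_self]
          exact hBL _ _ _ (by omega)
    have hdec : s.decide E sel idle = PMF.pure (sel s.outer.mean) := by
      simp [State.decide, hq, hage]
    rw [hdec]
    refine (add_le_add_left (stepMean_mono P _ hstep) _).trans ?_
    rw [stepMean_add, stepMean_const]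
    have := hBstep s.period s.age s.queue s.outer hage hq (hs.queue_le hq)
    simp only [W, hq, hage, if_false, if_true]
    linarith
  · have hstep : ∀ o : Obs N, W (s.step E o) ≤
        L s.period (s.age - s.period + 1) ((s.queue - o.2.1.toNat) + o.1.toNat)
          (learnUpdate E (s.age - s.period) s.inner o) + F (s.period + 1) s.outer := by
      intro o
      have hle : s.period ≤ s.age := not_lt.1 hage
      simp only [State.step, hq, if_false, W, hle, true_and, learnUpdate]
      by_cases h0 : (s.queue - o.2.1.toNat) + o.1.toNat = 0
      · simp only [h0, if_true]
        exact le_add_of_nonneg_left (hL0 _ _ _ _)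
      · simp only [h0, if_false]
        rw [if_neg (by omega), Nat.sub_add_comm hle]
    have hdec : s.decide E sel idle = learnDecide E sel (s.age - s.period) s.inner := by
      simp only [State.decide, learnDecide, hq, hage, if_false]
    rw [hdec]
    refine (add_le_add_left (stepMean_mono P _ hstep) _).trans ?_
    rw [stepMean_add, stepMean_const]
    have := hL s.period (s.age - s.period) s.queue s.inner hq
      (by have := hs.queue_le hq; omega) hs.inner_valid
    simp only [W, hq, hage, if_false]
    linarith

theorem exists_isArgmax [Nonempty (Fin N)] : ∃ sel : (Fin N → ℝ) → Fin N, IsArgmax sel := by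
  choose sel h using fun m : Fin N → ℝ => Finite.exists_max m
  exact ⟨sel, h⟩

end QueueRegret

end

theorem theorem4 (N : ℕ) (hN : 2 ≤ N) :
    -- one policy has bounded regret on every problem whose best server is stabilizing
    (∃ π : QueueRegret.Policy N, ∀ P : QueueRegret.Problem N,
      P.lam < P.mu P.best → QueueRegret.HasBoundedRegret π P) ∧
    -- and the policy `π₃` is such a policy, for every sublinear choice of its exploration slots
    (∃ E : Set ℕ, QueueRegret.IsSublinearExploration E) ∧
    (∀ (E : Set ℕ) (sel : (Fin N → ℝ) → Fin N) (idle : Fin N),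
      QueueRegret.IsSublinearExploration E → QueueRegret.IsArgmax sel →
      ∀ P : QueueRegret.Problem N,
        P.lam < P.mu P.best → QueueRegret.HasBoundedRegret (QueueRegret.piThree E sel idle) P) := by
  obtain ⟨E, hE⟩ := QueueRegret.exists_isSublinearExploration
  have idle : Fin N := ⟨0, by omega⟩
  have : Nonempty (Fin N) := ⟨idle⟩
  obtain ⟨sel, hsel⟩ := QueueRegret.exists_isArgmax (N := N)
  exact ⟨⟨QueueRegret.piThree E sel idle,
      fun P hP => QueueRegret.hasBoundedRegret_piThree idle hE hsel P hP⟩, ⟨E, hE⟩,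
    fun E sel idle hE hsel P hP => QueueRegret.hasBoundedRegret_piThree idle hE hsel P hP⟩
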